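/- Let $k$ be an algebraically closed field of characteristic $0$. For elements $a,b$ of a coalgebra put $P_{a,b}=\{x : \Delta(x)=x\otimes a+b\otimes x\}$; a Hopf algebra is pointed if all its simple subcoalgebras are one-dimensional. The coradical filtration of a coalgebra $A$ is given by $A_0$, the sum of the simple subcoalgebras of $A$, and $A_{n+1}=\Delta^{-1}(A\otimes A_n+A_0\otimes A)$. A datum $\mathcal D=(G,F,n)$ consists of a finite abelian group $G$, a bilinear form $F:G\times G\to k^*$ (a homomorphism in each variable) which is skew symmetric, $F(x,y)=F(y,x)^{-1}$, and non-degenerate, i.e. $x\mapsto F(x,\cdot)$ is an isomorphism $G\to G^*=\mathrm{Hom}(G,k^*)$, and a function $n:I_F\to\mathbb Z_{\ge 0}$, $g\mapsto n_g$, on $I_F=\{g\in G : F(g,g)=-1\}$. For $g\in I_F$ let $V_g$ be a $k$-vector space of dimension $n_g$, and let $\mathcal B=\bigoplus_{g\in I_F}V_g$. The Hopf algebra $H(\mathcal D)$ is the algebra generated by $G\cup\mathcal B$ subject to the relations of the group $G$, those of the vector spaces $V_g$, and $$xy=F(h,g)\,yx,\qquad xa=F(a,g)\,ax\qquad (g,h\in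 I_F,\ x\in V_g,\ y\in V_h,\ a\in G),$$ with $\Delta(a)=a\otimes a$, $\varepsilon(a)=1$ for $a\in G$ and $\Delta(x)=x\otimes 1+g\otimes x$, $\varepsilon(x)=0$ for $x\in V_g$. Put $B=\bigotimes_{g\in I_F}\bigwedge V_g$ (as a vector space), and $V_g=0$ for $g\in G\setminus I_F$. **Proposition 4.3.** Let $\mathcal D=(G,F,n)$ be a datum. 1) $H(\mathcal D)$ is pointed, and the canonical map from $G$ to the group of grouplike elements of $H(\mathcal D)$ is an isomorphism. 2) $H(\mathcal D)=B\times k[G]$ is a (Radford) biproduct. Explicitly, there is a homomorphism of Hopf algebras $\pi:H(\mathcal D)\to k[G]$ with $\pi(a)=a$ for $a\in G$ and $\pi(x)=0$ for $x\in\mathcal B$; and for each ordering $g_1,\dots,g_m$ of $I_F$, the linear map $j:B\to H(\mathcal D)$, $w_{g_1}\otimes\cdots\otimes w_{g_m}\mapsto w_{g_1}\cdots w_{g_m}$ (where $\bigwedge V_g\to H(\mathcal D)$ is the algebra map extending $V_g\to H(\mathcal D)$) has image $\{x : (\mathrm{id}\otimes\pi)\Delta(x)=x\otimes 1\}$, and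 there is on $B$ a structure of a Hopf algebra in the category of (left-left) Yetter-Drinfeld modules over $k[G]$ such that $b\otimes a\mapsto j(b)a$ is an isomorphism of Hopf algebras from the biproduct $B\times k[G]$ (the space $B\otimes k[G]$ with the smash product and the smash coproduct) onto $H(\mathcal D)$. 3) The spaces $V_g$ embed in $H(\mathcal D)$ and their sum there is direct (so that $\mathcal B\subseteq H(\mathcal D)$). Moreover $H(\mathcal D)_1=k[G]\oplus k[G]\mathcal B$, and for all $a,b\in G$ $$P_{a,b}(H(\mathcal D))=\mathrm{span}\{a-b\}\oplus aV_{a^{-1}b}.$$ -/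

import Mathlib

open scoped TensorProduct

/-! ### Coalgebra notions -/

section Coalgebra

variable (k A : Type*) [Field k] [AddCommGroup A] [Module k A] [Coalgebra k A]

/-- A subspace `C` of a coalgebra is a subcoalgebra if `Δ(C) ⊆ C ⊗ C`. -/
def IsSubcoalgebra {k A : Type*} [Field k] [AddCommGroup A] [Module k A] [Coalgebra k A]
    (C : Submodule k A) : Prop :=
  ∀ x ∈ C, Coalgebra.comul (R := k) x ∈ LinearMap.range (TensorProduct.map C.subtype C.subtype)

/-- A simple subcoalgebra: nonzero, and its only subcoalgebras are `0` and itself. -/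
def IsSimpleSubcoalgebra {k A : Type*} [Field k] [AddCommGroup A] [Module k A] [Coalgebra k A]
    (C : Submodule k A) : Prop :=
  IsSubcoalgebra C ∧ C ≠ ⊥ ∧ ∀ E : Submodule k A, IsSubcoalgebra E → E ≤ C → E = ⊥ ∨ E = C

/-- A coalgebra is pointed if all its simple subcoalgebras are one-dimensional. -/
def IsPointedCoalgebra : Prop :=
  ∀ C : Submodule k A, IsSimpleSubcoalgebra C → Module.finrank k C = 1

/-- The coradical: the sum of all simple subcoalgebras. -/
def coradical : Submodule k A := sSup {C : Submodule k A | IsSimpleSubcoalgebra C}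

/-- The coradical filtration: `A₀` is the coradical and
`Aₙ₊₁ = Δ⁻¹(A ⊗ Aₙ + A₀ ⊗ A)`. -/
def coradicalFiltration : ℕ → Submodule k A
  | 0 => coradical k A
  | n + 1 => Submodule.comap (Coalgebra.comul (R := k) (A := A))
      (LinearMap.range (LinearMap.lTensor A (coradicalFiltration n).subtype) ⊔
        LinearMap.range (LinearMap.rTensor A (coradical k A).subtype))

variable {A}

/-- The space `P_{a,b}` of `a : b` skew primitive elements, `Δ(x) = x ⊗ a + b ⊗ x`. -/
def skewPrimitives (a b : A) : Submodule k A where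
  carrier := {x | Coalgebra.comul (R := k) x = x ⊗ₜ[k] a + b ⊗ₜ[k] x}
  add_mem' := by
    intro x y hx hy
    simp only [Set.mem_ofPred_eq] at hx hy ⊢
    rw [map_add, hx, hy, TensorProduct.add_tmul, TensorProduct.tmul_add]
    abel
  zero_mem' := by simp
  smul_mem' := by
    intro c x hx
    simp only [Set.mem_ofPred_eq] at hx ⊢
    rw [map_smul, hx, smul_add, TensorProduct.smul_tmul', TensorProduct.tmul_smul]

end Coalgebra

/-! ### Hopf algebras in the Yetter-Drinfeld category, and Radford's biproduct -/

section Biproduct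

/-- `(m ⊗ n) ⊗ (p ⊗ q) ↦ (m ⊗ t(n ⊗ p)) ⊗ q`, rebracketed: apply `t` to the middle two factors. -/
noncomputable def midMap (k : Type*) [Field k] {M N P Q P' N' : Type*}
    [AddCommGroup M] [Module k M] [AddCommGroup N] [Module k N]
    [AddCommGroup P] [Module k P] [AddCommGroup Q] [Module k Q]
    [AddCommGroup P'] [Module k P'] [AddCommGroup N'] [Module k N']
    (t : N ⊗[k] P →ₗ[k] P' ⊗[k] N') :
    (M ⊗[k] N) ⊗[k] (P ⊗[k] Q) →ₗ[k] (M ⊗[k] P') ⊗[k] (N' ⊗[k] Q) :=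
  (TensorProduct.assoc k (M ⊗[k] P') N' Q).toLinearMap ∘ₗ
    LinearMap.rTensor Q ((TensorProduct.assoc k M P' N').symm.toLinearMap ∘ₗ
      LinearMap.lTensor M t ∘ₗ (TensorProduct.assoc k M N P).toLinearMap) ∘ₗ
    (TensorProduct.assoc k (M ⊗[k] N) P Q).symm.toLinearMap

variable (k K : Type*) [Field k] [Ring K] [HopfAlgebra k K]

section Maps

variable {B C : Type*} [AddCommGroup B] [Module k B] [AddCommGroup C] [Module k C] {k K}

/-- `h ⊗ b ↦ h₁ · b ⊗ h₂`, for an action of `K` on `B`. -/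
noncomputable def actTwist (act : K ⊗[k] B →ₗ[k] B) : K ⊗[k] B →ₗ[k] B ⊗[k] K :=
  LinearMap.rTensor K act ∘ₗ (TensorProduct.rightComm k K K B).toLinearMap ∘ₗ
    LinearMap.rTensor B (Coalgebra.comul (R := k) (A := K))

/-- `b ⊗ h ↦ b₍₋₁₎ h ⊗ b₍₀₎`, for a coaction of `K` on `B`. -/
noncomputable def coactTwist (coact : B →ₗ[k] K ⊗[k] B) : B ⊗[k] K →ₗ[k] K ⊗[k] B :=
  LinearMap.rTensor B (LinearMap.mul' k K) ∘ₗ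
    (TensorProduct.rightComm k K B K).toLinearMap ∘ₗ LinearMap.rTensor K coact

/-- The diagonal action `h ⊗ (b ⊗ c) ↦ h₁ · b ⊗ h₂ · c`. -/
noncomputable def diagAct (actB : K ⊗[k] B →ₗ[k] B) (actC : K ⊗[k] C →ₗ[k] C) :
    K ⊗[k] (B ⊗[k] C) →ₗ[k] B ⊗[k] C :=
  TensorProduct.map actB actC ∘ₗ (TensorProduct.tensorTensorTensorComm k K K B C).toLinearMap ∘ₗ
    LinearMap.rTensor (B ⊗[k] C) (Coalgebra.comul (R := k) (A := K))

/-- The diagonal coaction `b ⊗ c ↦ b₍₋₁₎ c₍₋₁₎ ⊗ (b₍₀₎ ⊗ c₍₀₎)`. -/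
noncomputable def diagCoact (coactB : B →ₗ[k] K ⊗[k] B) (coactC : C →ₗ[k] K ⊗[k] C) :
    B ⊗[k] C →ₗ[k] K ⊗[k] (B ⊗[k] C) :=
  LinearMap.rTensor (B ⊗[k] C) (LinearMap.mul' k K) ∘ₗ
    (TensorProduct.tensorTensorTensorComm k K B K C).toLinearMap ∘ₗ
    TensorProduct.map coactB coactC

/-- The Yetter-Drinfeld braiding `b ⊗ c ↦ b₍₋₁₎ · c ⊗ b₍₀₎`. -/
noncomputable def ydBraiding (coactB : B →ₗ[k] K ⊗[k] B) (actC : K ⊗[k] C →ₗ[k] C) :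
    B ⊗[k] C →ₗ[k] C ⊗[k] B :=
  LinearMap.rTensor B actC ∘ₗ (TensorProduct.rightComm k K B C).toLinearMap ∘ₗ
    LinearMap.rTensor C coactB

end Maps

/-- A Hopf algebra structure, on a vector space `B`, in the braided category of left-left
Yetter-Drinfeld modules over the Hopf algebra `K`. The operations are all part of the data, so
that no other multiplication that `B` may carry interferes. -/
structure YetterDrinfeldHopf (B : Type*) [AddCommGroup B] [Module k B] where
  /-- the action `h ⊗ b ↦ h · b` -/
  act : K ⊗[k] B →ₗ[k] B
  /-- the coaction `b ↦ b₍₋₁₎ ⊗ b₍₀₎` -/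
  coact : B →ₗ[k] K ⊗[k] B
  /-- the multiplication of `B` -/
  mul : B ⊗[k] B →ₗ[k] B
  /-- the unit of `B` -/
  one : B
  /-- the comultiplication of `B` -/
  comul : B →ₗ[k] B ⊗[k] B
  /-- the counit of `B` -/
  counit : B →ₗ[k] k
  /-- the antipode of `B` -/
  antipode : B →ₗ[k] B
  -- `B` is a left `K`-module
  one_act : ∀ b, act (1 ⊗ₜ b) = b
  mul_act : ∀ h h' b, act ((h * h') ⊗ₜ b) = act (h ⊗ₜ act (h' ⊗ₜ b))
  -- `B` is a left `K`-comodule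
  counit_coact : ∀ b,
    TensorProduct.lid k B (LinearMap.rTensor B (Coalgebra.counit (R := k) (A := K)) (coact b)) = b
  coassoc_coact : ∀ b,
    TensorProduct.assoc k K K B
        (LinearMap.rTensor B (Coalgebra.comul (R := k) (A := K)) (coact b)) =
      LinearMap.lTensor K coact (coact b)
  -- Yetter-Drinfeld: `h₁ b₍₋₁₎ ⊗ h₂ · b₍₀₎ = (h₁ · b)₍₋₁₎ h₂ ⊗ (h₁ · b)₍₀₎`
  yetter_drinfeld :
    TensorProduct.map (LinearMap.mul' k K) act ∘ₗ
        (TensorProduct.tensorTensorTensorComm k K K K B).toLinearMap ∘ₗ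
        TensorProduct.map (Coalgebra.comul (R := k) (A := K)) coact =
      coactTwist coact ∘ₗ actTwist act
  -- `B` is an associative unital algebra, whose operations are module and comodule maps
  mul_assoc : ∀ a b c, mul (mul (a ⊗ₜ b) ⊗ₜ c) = mul (a ⊗ₜ mul (b ⊗ₜ c))
  one_mul : ∀ b, mul (one ⊗ₜ b) = b
  mul_one : ∀ b, mul (b ⊗ₜ one) = b
  act_mul : ∀ h b c, act (h ⊗ₜ mul (b ⊗ₜ c)) = mul (diagAct act act (h ⊗ₜ (b ⊗ₜ c)))
  act_one : ∀ h, act (h ⊗ₜ one) = Coalgebra.counit (R := k) h • one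
  coact_mul : ∀ b c,
    coact (mul (b ⊗ₜ c)) = LinearMap.lTensor K mul (diagCoact coact coact (b ⊗ₜ c))
  coact_one : coact one = 1 ⊗ₜ one
  -- `B` is a coassociative counital coalgebra, whose operations are module and comodule maps
  coassoc : ∀ b, TensorProduct.assoc k B B B (LinearMap.rTensor B comul (comul b)) =
    LinearMap.lTensor B comul (comul b)
  rTensor_counit_comul : ∀ b, LinearMap.rTensor B counit (comul b) = 1 ⊗ₜ b
  lTensor_counit_comul : ∀ b, LinearMap.lTensor B counit (comul b) = b ⊗ₜ 1
  comul_act : ∀ h b, comul (act (h ⊗ₜ b)) = diagAct act act (h ⊗ₜ comul b)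
  counit_act : ∀ h b, counit (act (h ⊗ₜ b)) = Coalgebra.counit (R := k) h * counit b
  coact_comul : ∀ b, LinearMap.lTensor K comul (coact b) = diagCoact coact coact (comul b)
  coact_counit : ∀ b, LinearMap.lTensor K counit (coact b) = 1 ⊗ₜ counit b
  -- `Δ` and `ε` are algebra maps, `B ⊗ B` having the braided multiplication
  comul_mul : ∀ b c, comul (mul (b ⊗ₜ c)) =
    TensorProduct.map mul mul (midMap k (ydBraiding coact act) (comul b ⊗ₜ comul c))
  comul_one : comul one = one ⊗ₜ one
  counit_mul : ∀ b c, counit (mul (b ⊗ₜ c)) = counit b * counit c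
  counit_one : counit one = 1
  -- the antipode, a morphism of Yetter-Drinfeld modules
  antipode_act : ∀ h b, antipode (act (h ⊗ₜ b)) = act (h ⊗ₜ antipode b)
  antipode_coact : ∀ b, coact (antipode b) = LinearMap.lTensor K antipode (coact b)
  mul_antipode_left : ∀ b, mul (LinearMap.rTensor B antipode (comul b)) = counit b • one
  mul_antipode_right : ∀ b, mul (LinearMap.lTensor B antipode (comul b)) = counit b • one

namespace YetterDrinfeldHopf

variable {k K} {B : Type*} [AddCommGroup B] [Module k B] (Y : YetterDrinfeldHopf k K B)

/-- The multiplication of `B × K`: `(b × h)(c × h') = b (h₁ · c) × h₂ h'` (smash product). -/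
noncomputable def smashMul : (B ⊗[k] K) ⊗[k] (B ⊗[k] K) →ₗ[k] B ⊗[k] K :=
  TensorProduct.map Y.mul (LinearMap.mul' k K) ∘ₗ midMap k (actTwist Y.act)

/-- The comultiplication of `B × K`:
`Δ(b × h) = (b₁ × b₂₍₋₁₎ h₁) ⊗ (b₂₍₀₎ × h₂)` (smash coproduct). -/
noncomputable def smashComul : B ⊗[k] K →ₗ[k] (B ⊗[k] K) ⊗[k] (B ⊗[k] K) :=
  midMap k (coactTwist Y.coact) ∘ₗ
    TensorProduct.map Y.comul (Coalgebra.comul (R := k) (A := K))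

/-- The linear map `Φ : B ⊗ K → H` is an isomorphism of Hopf algebras from Radford's biproduct
`B × K` (the space `B ⊗ K` with the smash product and the smash coproduct) onto `H`. The antipode
of a Hopf algebra is determined by the bialgebra structure, so that it needs no clause. -/
structure IsBiproductIso {H : Type*} [Ring H] [HopfAlgebra k H]
    (Φ : B ⊗[k] K →ₗ[k] H) : Prop where
  bijective : Function.Bijective Φ
  map_mul : ∀ u v, Φ (Y.smashMul (u ⊗ₜ v)) = Φ u * Φ v
  map_one : Φ (Y.one ⊗ₜ 1) = 1
  map_comul : ∀ u, Coalgebra.comul (R := k) (Φ u) = TensorProduct.map Φ Φ (Y.smashComul u)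
  map_counit : ∀ b h, Coalgebra.counit (R := k) (Φ (b ⊗ₜ h)) =
    Y.counit b * Coalgebra.counit (R := k) h

end YetterDrinfeldHopf

end Biproduct

/-- The right coinvariants `{x | (id ⊗ π) Δ(x) = x ⊗ 1}` of a bialgebra map `π : A → K`. -/
def rightCoinvariants {k A K : Type*} [Field k] [Ring A] [Bialgebra k A] [Ring K] [Bialgebra k K]
    (π : A →ₐc[k] K) : Set A :=
  {x | LinearMap.lTensor A (π : A →ₗ[k] K) (Coalgebra.comul (R := k) x) = x ⊗ₜ[k] (1 : K)}

/-! ### Data, and the Hopf algebra of a datum -/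

/-- A datum `(G, F, n)`: a non-degenerate skew symmetric bicharacter `F : G × G → kˣ` and a
function `n` with values in the non-negative integers on the set `I_F = {g | F(g, g) = -1}`. -/
structure Datum (k G : Type*) [Field k] [CommGroup G] where
  /-- the bilinear form -/
  F : G →* G →* kˣ
  skew : ∀ x y, F x y = (F y x)⁻¹
  -- the map `G → G^*`, `x ↦ F(x, ·)`, is an isomorphism
  nondegenerate : Function.Bijective F
  /-- the dimensions -/
  n : {g : G // F g g = -1} → ℕ

namespace Datum

variable {k G : Type*} [Field k] [CommGroup G] (D : Datum k G)

/-- The index set `I_F = {g | F(g, g) = -1}`. -/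
abbrev I : Type _ := {g : G // D.F g g = -1}

/-- The vector space `V_g`, of dimension `n_g`. -/
abbrev V (g : D.I) : Type _ := Fin (D.n g) → k

/-- The generators of `H(D)`: the elements of `G` and those of the spaces `V_g`. -/
abbrev Gen : Type _ := G ⊕ (Σ g : D.I, D.V g)

/-- The element `a ∈ G` of the free algebra. -/
def preGrp (a : G) : FreeAlgebra k D.Gen := FreeAlgebra.ι k (Sum.inl a)

/-- The element `x ∈ V_g` of the free algebra. -/
def preVec (g : D.I) (x : D.V g) : FreeAlgebra k D.Gen := FreeAlgebra.ι k (Sum.inr ⟨g, x⟩)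

/-- The defining relations of `H(D)`: those of the group `G` and of the vector spaces `V_g`,
and `x y = F(h, g) y x`, `x a = F(a, g) a x` for `x ∈ V_g`, `y ∈ V_h`, `a ∈ G`. -/
inductive Rel : FreeAlgebra k D.Gen → FreeAlgebra k D.Gen → Prop
  | grp_one : Rel (D.preGrp 1) 1
  | grp_mul (a b : G) : Rel (D.preGrp (a * b)) (D.preGrp a * D.preGrp b)
  | vec_add (g : D.I) (x y : D.V g) : Rel (D.preVec g (x + y)) (D.preVec g x + D.preVec g y)
  | vec_smul (g : D.I) (c : k) (x : D.V g) : Rel (D.preVec g (c • x)) (c • D.preVec g x)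
  | vec_vec (g h : D.I) (x : D.V g) (y : D.V h) :
      Rel (D.preVec g x * D.preVec h y)
        ((D.F h.1 g.1 : k) • (D.preVec h y * D.preVec g x))
  | vec_grp (g : D.I) (x : D.V g) (a : G) :
      Rel (D.preVec g x * D.preGrp a) ((D.F a g.1 : k) • (D.preGrp a * D.preVec g x))

/-- The algebra `H(D)`. -/
def H : Type _ := RingQuot D.Rel

noncomputable instance : Ring D.H := inferInstanceAs (Ring (RingQuot D.Rel))

noncomputable instance : Algebra k D.H := inferInstanceAs (Algebra k (RingQuot D.Rel))

/-- The quotient map from the free algebra. -/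
noncomputable def quot : FreeAlgebra k D.Gen →ₐ[k] D.H := RingQuot.mkAlgHom k D.Rel

/-- The map `G → H(D)`. -/
noncomputable def grp : G →* D.H where
  toFun a := D.quot (D.preGrp a)
  map_one' := (RingQuot.mkAlgHom_rel k Rel.grp_one).trans (map_one D.quot)
  map_mul' a b := (RingQuot.mkAlgHom_rel k (Rel.grp_mul a b)).trans (map_mul D.quot _ _)

/-- The map `V_g → H(D)`. -/
noncomputable def vec (g : D.I) : D.V g →ₗ[k] D.H where
  toFun x := D.quot (D.preVec g x)
  map_add' x y := (RingQuot.mkAlgHom_rel k (Rel.vec_add g x y)).trans (map_add D.quot _ _)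
  map_smul' c x := (RingQuot.mkAlgHom_rel k (Rel.vec_smul g c x)).trans (map_smul D.quot _ _)

theorem vec_mul_vec (g h : D.I) (x : D.V g) (y : D.V h) :
    D.vec g x * D.vec h y = (D.F h.1 g.1 : k) • (D.vec h y * D.vec g x) := by
  have := RingQuot.mkAlgHom_rel k (Rel.vec_vec g h x y)
  change D.quot _ = D.quot _ at this
  simpa only [map_mul, map_smul] using! this

theorem vec_mul_grp (g : D.I) (x : D.V g) (a : G) :
    D.vec g x * D.grp a = (D.F a g.1 : k) • (D.grp a * D.vec g x) := by
  have := RingQuot.mkAlgHom_rel k (Rel.vec_grp g x a)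
  change D.quot _ = D.quot _ at this
  simpa only [map_mul, map_smul] using! this

/-- The universal property of `H(D)`. -/
noncomputable def lift {A : Type*} [Ring A] [Algebra k A] (u : G →* A)
    (v : ∀ g : D.I, D.V g →ₗ[k] A)
    (hvv : ∀ g h x y, v g x * v h y = (D.F h.1 g.1 : k) • (v h y * v g x))
    (hvu : ∀ g x a, v g x * u a = (D.F a g.1 : k) • (u a * v g x)) : D.H →ₐ[k] A :=
  RingQuot.liftAlgHom k ⟨FreeAlgebra.lift k (Sum.elim u fun p => v p.1 p.2), by
    intro a b r
    cases r with
    | grp_one => simp [preGrp]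
    | grp_mul a b => simp [preGrp]
    | vec_add g x y => simp [preVec]
    | vec_smul g c x => simp [preVec]
    | vec_vec g h x y => simpa [preVec] using hvv g h x y
    | vec_grp g x a => simpa [preGrp, preVec] using hvu g x a⟩

section lift

variable {A : Type*} [Ring A] [Algebra k A] (u : G →* A) (v : ∀ g : D.I, D.V g →ₗ[k] A)
    (hvv : ∀ g h x y, v g x * v h y = (D.F h.1 g.1 : k) • (v h y * v g x))
    (hvu : ∀ g x a, v g x * u a = (D.F a g.1 : k) • (u a * v g x))

@[simp] theorem lift_grp (a : G) : D.lift u v hvv hvu (D.grp a) = u a := by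
  change RingQuot.liftAlgHom k _ (RingQuot.mkAlgHom k D.Rel _) = _
  rw [RingQuot.liftAlgHom_mkAlgHom_apply]
  simp [preGrp]

@[simp] theorem lift_vec (g : D.I) (x : D.V g) : D.lift u v hvv hvu (D.vec g x) = v g x := by
  change RingQuot.liftAlgHom k _ (RingQuot.mkAlgHom k D.Rel _) = _
  rw [RingQuot.liftAlgHom_mkAlgHom_apply]
  simp [preVec]

end lift

/-- `H(D)` is generated as an algebra by `G` and the spaces `V_g`. -/
theorem induction {P : D.H → Prop} (hgrp : ∀ a, P (D.grp a)) (hvec : ∀ g x, P (D.vec g x))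
    (hscal : ∀ c : k, P (algebraMap k D.H c)) (hadd : ∀ x y, P x → P y → P (x + y))
    (hmul : ∀ x y, P x → P y → P (x * y)) (z : D.H) : P z := by
  obtain ⟨w, rfl⟩ := RingQuot.mkAlgHom_surjective k D.Rel z
  change P (D.quot w)
  induction w using FreeAlgebra.induction with
  | grade0 c => simpa only [AlgHom.commutes] using hscal c
  | grade1 s =>
    rcases s with a | ⟨g, x⟩
    · exact hgrp a
    · exact hvec g x
  | mul a b ha hb => simpa only [map_mul] using hmul _ _ ha hb
  | add a b ha hb => simpa only [map_add] using hadd _ _ ha hb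

theorem algHom_ext {A : Type*} [Ring A] [Algebra k A] {f f' : D.H →ₐ[k] A}
    (hgrp : ∀ a, f (D.grp a) = f' (D.grp a)) (hvec : ∀ g x, f (D.vec g x) = f' (D.vec g x)) :
    f = f' := by
  ext z
  induction z using D.induction with
  | hgrp a => exact hgrp a
  | hvec g x => exact hvec g x
  | hscal c => simp
  | hadd x y hx hy => simp [hx, hy]
  | hmul x y hx hy => simp [hx, hy]

theorem F_mul_swap (x y : G) : (D.F x y : k) * (D.F y x : k) = 1 := by
  rw [D.skew x y]; simp

theorem grp_mul_vec (g : D.I) (x : D.V g) (a : G) :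
    D.grp a * D.vec g x = (D.F g.1 a : k) • (D.vec g x * D.grp a) := by
  rw [vec_mul_grp, smul_smul, F_mul_swap, one_smul]

/-- The map `a ↦ a ⊗ a` on `G`. -/
noncomputable def comulGrp : G →* D.H ⊗[k] D.H where
  toFun a := D.grp a ⊗ₜ D.grp a
  map_one' := by rw [map_one, Algebra.TensorProduct.one_def]
  map_mul' a b := by rw [map_mul, Algebra.TensorProduct.tmul_mul_tmul]

theorem comulGrp_apply (a : G) : D.comulGrp a = D.grp a ⊗ₜ D.grp a := rfl

/-- The map `x ↦ x ⊗ 1 + g ⊗ x` on `V_g`. -/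
noncomputable def comulVec (g : D.I) : D.V g →ₗ[k] D.H ⊗[k] D.H where
  toFun x := D.vec g x ⊗ₜ 1 + D.grp g.1 ⊗ₜ D.vec g x
  map_add' x y := by
    simp only [map_add, TensorProduct.add_tmul, TensorProduct.tmul_add]
    abel
  map_smul' c x := by
    simp only [map_smul, ← TensorProduct.smul_tmul', TensorProduct.tmul_smul, smul_add,
      RingHom.id_apply]

theorem comulVec_apply (g : D.I) (x : D.V g) :
    D.comulVec g x = D.vec g x ⊗ₜ 1 + D.grp g.1 ⊗ₜ D.vec g x := rfl

/-- The comultiplication, as an algebra map: `Δ(a) = a ⊗ a` for `a ∈ G`, and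
`Δ(x) = x ⊗ 1 + g ⊗ x` for `x ∈ V_g`. -/
noncomputable def comulHom : D.H →ₐ[k] D.H ⊗[k] D.H :=
  D.lift D.comulGrp D.comulVec
    (by
      intro g h x y
      simp only [comulVec_apply, mul_add, add_mul,
        Algebra.TensorProduct.tmul_mul_tmul, mul_one, one_mul, smul_add]
      rw [vec_mul_vec D g h x y, vec_mul_grp D g x h.1, grp_mul_vec D h y g.1,
        ← map_mul, ← map_mul, mul_comm g.1 h.1]
      simp only [← TensorProduct.smul_tmul', TensorProduct.tmul_smul]
      abel)
    (by
      intro g x a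
      simp only [comulVec_apply, comulGrp_apply, mul_add,
        add_mul, Algebra.TensorProduct.tmul_mul_tmul, mul_one, one_mul, smul_add]
      rw [vec_mul_grp D g x a, ← map_mul, ← map_mul, mul_comm g.1 a]
      simp only [← TensorProduct.smul_tmul', TensorProduct.tmul_smul])

/-- The counit, as an algebra map: `ε(a) = 1` for `a ∈ G`, and `ε(x) = 0` for `x ∈ V_g`. -/
noncomputable def counitHom : D.H →ₐ[k] k :=
  D.lift 1 (fun _ => 0) (by simp) (by simp)

noncomputable instance : Bialgebra k D.H :=
  Bialgebra.ofAlgHom D.comulHom D.counitHom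
    (by
      apply D.algHom_ext
      · intro a; simp [comulHom, comulGrp_apply]
      · intro g x
        simp [comulHom, comulGrp_apply, comulVec_apply, TensorProduct.tmul_add, TensorProduct.add_tmul,
          Algebra.TensorProduct.one_def]
        abel)
    (by apply D.algHom_ext <;> intros <;> simp [comulHom, counitHom, comulGrp_apply, comulVec_apply])
    (by apply D.algHom_ext <;> intros <;> simp [comulHom, counitHom, comulGrp_apply, comulVec_apply])

@[simp] theorem comul_grp (a : G) :
    Coalgebra.comul (R := k) (D.grp a) = D.grp a ⊗ₜ D.grp a :=
  D.lift_grp _ _ _ _ a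

@[simp] theorem comul_vec (g : D.I) (x : D.V g) :
    Coalgebra.comul (R := k) (D.vec g x) = D.vec g x ⊗ₜ 1 + D.grp g.1 ⊗ₜ D.vec g x :=
  D.lift_vec _ _ _ _ g x

@[simp] theorem counit_grp (a : G) : Coalgebra.counit (R := k) (D.grp a) = 1 :=
  D.lift_grp _ _ _ _ a

@[simp] theorem counit_vec (g : D.I) (x : D.V g) :
    Coalgebra.counit (R := k) (D.vec g x) = 0 :=
  D.lift_vec _ _ _ _ g x

theorem F_inv_left (a b : G) : (D.F a⁻¹ b : k) = (D.F b a : k) := by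
  rw [D.skew b a]; simp

/-- The map `a ↦ a⁻¹` on `G`, with values in the opposite algebra. -/
noncomputable def antipodeGrp : G →* D.Hᵐᵒᵖ where
  toFun a := MulOpposite.op (D.grp a⁻¹)
  map_one' := by rw [inv_one, map_one, MulOpposite.op_one]
  map_mul' a b := by rw [← MulOpposite.op_mul, ← map_mul, mul_inv_rev]

theorem antipodeGrp_apply (a : G) : D.antipodeGrp a = MulOpposite.op (D.grp a⁻¹) := rfl

/-- The map `x ↦ -g⁻¹ x` on `V_g`, with values in the opposite algebra. -/
noncomputable def antipodeVec (g : D.I) : D.V g →ₗ[k] D.Hᵐᵒᵖ where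
  toFun x := MulOpposite.op (-(D.grp g.1⁻¹ * D.vec g x))
  map_add' x y := by rw [← MulOpposite.op_add, map_add, mul_add, neg_add]
  map_smul' c x := by
    rw [map_smul, mul_smul_comm, ← smul_neg, MulOpposite.op_smul, RingHom.id_apply]

theorem antipodeVec_apply (g : D.I) (x : D.V g) :
    D.antipodeVec g x = MulOpposite.op (-(D.grp g.1⁻¹ * D.vec g x)) := rfl

/-- The antipode, as an algebra map to the opposite algebra: `S(a) = a⁻¹` for `a ∈ G`, and
`S(x) = -g⁻¹ x` for `x ∈ V_g`. -/
noncomputable def antipodeHom : D.H →ₐ[k] D.Hᵐᵒᵖ :=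
  D.lift D.antipodeGrp D.antipodeVec
    (by
      intro g h x y
      simp only [antipodeVec_apply, ← MulOpposite.op_mul, ← MulOpposite.op_smul, neg_mul_neg]
      congr 1
      have e1 : ∀ (g h : D.I) (x : D.V g) (y : D.V h),
          D.grp h.1⁻¹ * D.vec h y * (D.grp g.1⁻¹ * D.vec g x) =
            (D.F h.1 g.1 : k) • (D.grp (h.1⁻¹ * g.1⁻¹) * (D.vec h y * D.vec g x)) := by
        intro g h x y
        rw [mul_assoc, ← mul_assoc (D.vec h y), vec_mul_grp, F_inv_left]
        simp only [smul_mul_assoc, mul_smul_comm, map_mul, mul_assoc]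
      rw [e1 g h x y, e1 h g y x, D.vec_mul_vec g h x y, mul_comm g.1⁻¹ h.1⁻¹]
      simp only [mul_smul_comm, smul_smul]
      rw [F_mul_swap, mul_one])
    (by
      intro g x a
      simp only [antipodeVec_apply, antipodeGrp_apply, ← MulOpposite.op_mul,
        ← MulOpposite.op_smul]
      congr 1
      rw [neg_mul, mul_neg, mul_assoc (D.grp g.1⁻¹), vec_mul_grp, F_inv_left]
      simp only [mul_smul_comm, smul_neg, smul_smul]
      rw [F_mul_swap, one_smul, ← mul_assoc, ← mul_assoc, ← map_mul, ← map_mul,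
        mul_comm a⁻¹])

/-- The antipode as a linear map. -/
noncomputable def antipodeLin : D.H →ₗ[k] D.H :=
  (MulOpposite.opLinearEquiv k).symm.toLinearMap ∘ₗ D.antipodeHom.toLinearMap

theorem antipodeLin_grp (a : G) : D.antipodeLin (D.grp a) = D.grp a⁻¹ := by
  simp [antipodeLin, antipodeHom, antipodeGrp_apply]

theorem antipodeLin_vec (g : D.I) (x : D.V g) :
    D.antipodeLin (D.vec g x) = -(D.grp g.1⁻¹ * D.vec g x) := by
  simp [antipodeLin, antipodeHom, antipodeVec_apply]

theorem antipodeLin_mul (x y : D.H) :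
    D.antipodeLin (x * y) = D.antipodeLin y * D.antipodeLin x := by
  simp [antipodeLin]

theorem antipodeLin_algebraMap (c : k) :
    D.antipodeLin (algebraMap k D.H c) = algebraMap k D.H c := by
  simp [antipodeLin]

theorem antipode_left_mul (t s : D.H ⊗[k] D.H) (c : k)
    (ht : LinearMap.mul' k D.H (LinearMap.rTensor D.H D.antipodeLin t) = algebraMap k D.H c) :
    LinearMap.mul' k D.H (LinearMap.rTensor D.H D.antipodeLin (t * s)) =
      c • LinearMap.mul' k D.H (LinearMap.rTensor D.H D.antipodeLin s) := by
  have key : ∀ (t : D.H ⊗[k] D.H) (b b' : D.H),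
      LinearMap.mul' k D.H (LinearMap.rTensor D.H D.antipodeLin (t * (b ⊗ₜ b'))) =
        D.antipodeLin b *
          LinearMap.mul' k D.H (LinearMap.rTensor D.H D.antipodeLin t) * b' := by
    intro t b b'
    induction t with
    | zero => simp
    | tmul x y => simp [antipodeLin_mul, mul_assoc]
    | add x y hx hy => simp only [add_mul, map_add, hx, hy, mul_add]
  induction s with
  | zero => simp
  | tmul b b' =>
    rw [key, ht, ← Algebra.commutes, mul_assoc, ← Algebra.smul_def]
    simp
  | add x y hx hy => simp only [mul_add, map_add, hx, hy, smul_add]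

theorem antipode_right_mul (t s : D.H ⊗[k] D.H) (c : k)
    (hs : LinearMap.mul' k D.H (LinearMap.lTensor D.H D.antipodeLin s) = algebraMap k D.H c) :
    LinearMap.mul' k D.H (LinearMap.lTensor D.H D.antipodeLin (t * s)) =
      c • LinearMap.mul' k D.H (LinearMap.lTensor D.H D.antipodeLin t) := by
  have key : ∀ (s : D.H ⊗[k] D.H) (b b' : D.H),
      LinearMap.mul' k D.H (LinearMap.lTensor D.H D.antipodeLin ((b ⊗ₜ b') * s)) =
        b * LinearMap.mul' k D.H (LinearMap.lTensor D.H D.antipodeLin s) *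
          D.antipodeLin b' := by
    intro s b b'
    induction s with
    | zero => simp
    | tmul x y => simp [antipodeLin_mul, mul_assoc]
    | add x y hx hy => simp only [add_mul, map_add, hx, hy, mul_add]
  induction t with
  | zero => simp
  | tmul b b' =>
    rw [key, hs, ← Algebra.commutes, mul_assoc, ← Algebra.smul_def]
    simp
  | add x y hx hy => simp only [add_mul, map_add, hx, hy, smul_add]

/-- The Hopf algebra `H(D)`. -/
noncomputable instance : HopfAlgebra k D.H where
  antipode := D.antipodeLin
  mul_antipode_rTensor_comul := by
    ext z
    change LinearMap.mul' k D.H (LinearMap.rTensor D.H D.antipodeLin (Coalgebra.comul z)) =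
      algebraMap k D.H (Coalgebra.counit z)
    induction z using D.induction with
    | hgrp a => simp [antipodeLin_grp, ← map_mul]
    | hvec g x =>
      have h1 := D.antipodeLin_algebraMap 1
      simp [antipodeLin_vec, antipodeLin_grp]
    | hscal c => simp [antipodeLin_algebraMap, Algebra.TensorProduct.algebraMap_apply]
    | hadd x y hx hy => simp only [map_add, hx, hy]
    | hmul x y hx hy =>
      rw [Bialgebra.comul_mul, D.antipode_left_mul _ _ _ hx, hy, Bialgebra.counit_mul,
        map_mul, Algebra.smul_def]
  mul_antipode_lTensor_comul := by
    ext z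
    change LinearMap.mul' k D.H (LinearMap.lTensor D.H D.antipodeLin (Coalgebra.comul z)) =
      algebraMap k D.H (Coalgebra.counit z)
    induction z using D.induction with
    | hgrp a => simp [antipodeLin_grp, ← map_mul]
    | hvec g x =>
      have h1 := D.antipodeLin_algebraMap 1
      simp only [map_one] at h1
      simp [antipodeLin_vec, h1, ← mul_assoc, ← map_mul]
    | hscal c =>
      have h1 := D.antipodeLin_algebraMap 1
      simp only [map_one] at h1
      simp [h1, Algebra.TensorProduct.algebraMap_apply]
    | hadd x y hx hy => simp only [map_add, hx, hy]
    | hmul x y hx hy =>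
      rw [Bialgebra.comul_mul, D.antipode_right_mul _ _ _ hy, hx, Bialgebra.counit_mul,
        map_mul, Algebra.smul_def, Algebra.commutes]

/-- The map from `G` to the group of grouplike elements of `H(D)`. -/
noncomputable def toGroupLike : G →* GroupLike k D.H where
  toFun a := ⟨D.grp a, ⟨D.counit_grp a, D.comul_grp a⟩⟩
  map_one' := by ext; simp
  map_mul' a b := by ext; simp

/-- The algebra map `k[G] → H(D)`. -/
noncomputable def groupAlg : MonoidAlgebra k G →ₐ[k] D.H := MonoidAlgebra.lift k D.H G D.grp

/-- The subspace `k[G]` of `H(D)`. -/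
noncomputable def kG : Submodule k D.H := LinearMap.range D.groupAlg.toLinearMap

/-- The subspace `V_g` of `H(D)` for any `g ∈ G`, which is `0` if `g ∉ I_F`. -/
noncomputable def vecSpace (g : G) : Submodule k D.H :=
  ⨆ h : D.F g g = -1, LinearMap.range (D.vec ⟨g, h⟩)

/-- The subspace `⨁ V_g` of `H(D)`. -/
noncomputable def vecSum : Submodule k D.H := ⨆ g : D.I, LinearMap.range (D.vec g)

/-- The vector space `⨂_{g ∈ I_F} ⋀ V_g`. -/
abbrev B : Type _ := ⨂[k] g : D.I, ExteriorAlgebra k (D.V g)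

theorem vec_mul_self [CharZero k] (g : D.I) (x : D.V g) : D.vec g x * D.vec g x = 0 := by
  have h := D.vec_mul_vec g g x x
  rw [g.2] at h
  simp only [Units.val_neg, Units.val_one, neg_smul, one_smul] at h
  have h2 : (2 : k) • (D.vec g x * D.vec g x) = 0 := by
    rw [two_smul]; nth_rewrite 1 [h]; simp
  exact (smul_eq_zero.mp h2).resolve_left two_ne_zero

/-- The algebra map `⋀ V_g → H(D)` that extends `V_g → H(D)`. -/
noncomputable def exterior [CharZero k] (g : D.I) : ExteriorAlgebra k (D.V g) →ₐ[k] D.H :=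
  ExteriorAlgebra.lift k ⟨D.vec g, D.vec_mul_self g⟩

/-- For an ordering `g₁, …, gₘ` of `I_F`, the linear map `⨂ ⋀ V_g → H(D)` which sends `⨂ w_g` to
the product `w_{g₁} ⋯ w_{gₘ}`. -/
noncomputable def tensorIncl [CharZero k] {m : ℕ} (e : Fin m ≃ D.I) : D.B →ₗ[k] D.H :=
  PiTensorProduct.lift
    (((MultilinearMap.mkPiAlgebraFin k m D.H).domDomCongr e).compLinearMap
      fun g => (D.exterior g).toLinearMap)

theorem tensorIncl_tprod [CharZero k] {m : ℕ} (e : Fin m ≃ D.I)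
    (w : ∀ g : D.I, ExteriorAlgebra k (D.V g)) :
    D.tensorIncl e (PiTensorProduct.tprod k w) =
      (List.ofFn fun i => D.exterior (e i) (w (e i))).prod := by
  simp [tensorIncl]

/-- The linear map `(⨂ ⋀ V_g) ⊗ k[G] → H(D)`, `b ⊗ a ↦ b a`. -/
noncomputable def biproductMap [CharZero k] {m : ℕ} (e : Fin m ≃ D.I) :
    D.B ⊗[k] MonoidAlgebra k G →ₗ[k] D.H :=
  LinearMap.mul' k D.H ∘ₗ TensorProduct.map (D.tensorIncl e) D.groupAlg.toLinearMap

end Datum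

/-! Choose a basis of the sum of the `V_g` and enumerate it as `x_i`, with `x_i` of degree `g_i ∈
I_F`. For a finite set `S` of indices let `x_S` be the product of its `x_i` in increasing order
(`mono`) and `g_S` the product of the `g_i` (`deg`). Everything rests on one fact, `pbw`: the
elements `x_S a` with `a ∈ G` form a basis of `H(D)`. They span because the relations let generators
pass each other up to a scalar, and `x_i² = 0` since `F(g_i, g_i) = -1` and `2 ≠ 0`. They are
independent because the same formulas define an action of `H(D)` on the free space on the pairs `(S,
a)`, and there `x_S a` sends the vector `(∅, 1)` to `(S, a)`.

In this basis `Δ(x_S a) = ∑_{T ⊆ S} c_{S,T} x_T g_{S∖T} a ⊗ x_{S∖T} a` with every `c_{S,T}`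
invertible (`exists_comul_mono`). Each coordinate of `Δ(x)` is therefore zero or an invertible
multiple of a single coordinate of `x` (`coordPair_comul`), and any splitting of `S` into two
disjoint pieces detects the coordinates of `x` at `S`. From this: a nonzero subcoalgebra contains an
element of `G` (`exists_grp_mem`), which gives pointedness, the coradical and the grouplike
elements; a monomial of length at least `2` splits into two nonempty pieces, which gives `H(D)₁`;
and comparison with `x ⊗ a + b ⊗ x` gives `P_{a,b}`.

For the biproduct, the coinvariants of the projection to `k[G]` are the span of the `x_S`
(`coe_monoSpan`). For any ordering of `I_F` the tensor product of the exterior algebras maps onto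
this span, and bijectively because both have dimension `2 ^ dim`. The braided Hopf algebra gets its
product from the inclusion `x_S ↦ x_S` into `H(D)`, its coproduct from the projection `x_S a ↦ x_S`,
its action from conjugation by `G` and its coaction from the degree. The axioms and the isomorphism
are checked on basis vectors (`ydHopf`, `isBiproductIso_ydHopf`). -/

namespace Datum

variable {k G : Type*} [Field k] [CommGroup G] (D : Datum k G)

/-! ### Ordered monomials -/

/-- The indices of the basis vectors of `⨁ V_g`. -/
abbrev Idx : Type _ := Σ g : D.I, Fin (D.n g)

/-- The dimension of `⨁ V_g`. -/
noncomputable def dim : ℕ := Nat.card D.Idx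

section Monomials

variable [Finite G]

/-- An enumeration of the basis vectors of `⨁ V_g`. -/
noncomputable def idx : Fin D.dim ≃ D.Idx := (Finite.equivFin D.Idx).symm

/-- The element of `I_F` which the `i`-th basis vector belongs to. -/
noncomputable def wt (i : Fin D.dim) : D.I := (D.idx i).1

/-- The `i`-th basis vector, in `H(D)`. -/
noncomputable def gen (i : Fin D.dim) : D.H := D.vec (D.idx i).1 (Pi.single (D.idx i).2 1)

/-- The product of the basis vectors in `S`, in increasing order. -/
noncomputable def mono (S : Finset (Fin D.dim)) : D.H := ((S.sort (· ≤ ·)).map D.gen).prod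

/-- The degree in `G` of the monomial of `S`. -/
noncomputable def deg (S : Finset (Fin D.dim)) : G := ∏ i ∈ S, (D.wt i).1

/-- The sign that moves the `i`-th basis vector to its place in a monomial. -/
noncomputable def sgn (i : Fin D.dim) (S : Finset (Fin D.dim)) : k :=
  ∏ j ∈ S with j < i, (D.F (D.wt j).1 (D.wt i).1 : k)

@[simp] theorem mono_empty : D.mono ∅ = 1 := by simp [mono]

@[simp] theorem deg_empty : D.deg ∅ = 1 := by simp [deg]

theorem deg_insert {i : Fin D.dim} {S : Finset (Fin D.dim)} (h : i ∉ S) :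
    D.deg (insert i S) = (D.wt i).1 * D.deg S := Finset.prod_insert h

theorem deg_union {S T : Finset (Fin D.dim)} (h : Disjoint S T) :
    D.deg (S ∪ T) = D.deg S * D.deg T := Finset.prod_union h

theorem deg_sdiff_mul {S T : Finset (Fin D.dim)} (h : T ⊆ S) :
    D.deg (S \ T) * D.deg T = D.deg S := Finset.prod_sdiff h

theorem mono_insert {i : Fin D.dim} {S : Finset (Fin D.dim)} (h : ∀ j ∈ S, i < j) :
    D.mono (insert i S) = D.gen i * D.mono S := by
  rw [mono, Finset.sort_insert _ (fun j hj => (h j hj).le) (fun hi => lt_irrefl _ (h i hi))]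
  rfl

theorem mono_singleton (i : Fin D.dim) : D.mono {i} = D.gen i := by simp [mono]

theorem gen_mul_gen (i j : Fin D.dim) :
    D.gen i * D.gen j = (D.F (D.wt j).1 (D.wt i).1 : k) • (D.gen j * D.gen i) :=
  D.vec_mul_vec _ _ _ _

theorem gen_mul_grp (i : Fin D.dim) (a : G) :
    D.gen i * D.grp a = (D.F a (D.wt i).1 : k) • (D.grp a * D.gen i) :=
  D.vec_mul_grp _ _ _

theorem grp_mul_gen (i : Fin D.dim) (a : G) :
    D.grp a * D.gen i = (D.F (D.wt i).1 a : k) • (D.gen i * D.grp a) :=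
  D.grp_mul_vec _ _ _

theorem grp_mul_mono (S : Finset (Fin D.dim)) (a : G) :
    D.grp a * D.mono S = (D.F (D.deg S) a : k) • (D.mono S * D.grp a) := by
  induction S using Finset.induction_on_min with
  | empty => simp
  | insert i S h ih =>
    have hi : i ∉ S := fun hi => lt_irrefl _ (h i hi)
    rw [D.mono_insert h, D.deg_insert hi, ← mul_assoc, grp_mul_gen, smul_mul_assoc, mul_assoc, ih,
      mul_smul_comm, smul_smul, mul_assoc]
    simp

theorem mono_mul_grp (S : Finset (Fin D.dim)) (a : G) :
    D.mono S * D.grp a = (D.F a (D.deg S) : k) • (D.grp a * D.mono S) := by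
  rw [grp_mul_mono, smul_smul, F_mul_swap, one_smul]

theorem vec_eq_sum (g : D.I) (x : D.V g) :
    D.vec g x = ∑ i, x i • D.gen (D.idx.symm ⟨g, i⟩) := by
  conv_lhs => rw [pi_eq_sum_univ' x]
  rw [map_sum]
  refine Finset.sum_congr rfl fun i _ => ?_
  rw [map_smul, gen, Equiv.apply_symm_apply]

theorem wt_symm (g : D.I) (i : Fin (D.n g)) : D.wt (D.idx.symm ⟨g, i⟩) = g := by
  simp [wt]

theorem gen_mem_range (i : Fin D.dim) : D.gen i ∈ LinearMap.range (D.vec (D.wt i)) := ⟨_, rfl⟩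

/-- The new generator moves right past the smaller ones, which produces `sgn`, and dies if it meets
its own copy. The induction splits off the least index `m` of the monomial: for `i < m` nothing
moves, for `i = m` a square appears, for `m < i` one swap leads to the smaller monomial. The action
`modelGen` copies this formula. -/
theorem gen_mul_mono [CharZero k] (i : Fin D.dim) (S : Finset (Fin D.dim)) :
    D.gen i * D.mono S = if i ∈ S then 0 else D.sgn i S • D.mono (insert i S) := by
  induction S using Finset.induction_on_min with
  | empty => simp [sgn, mono_singleton]
  | insert m S h ih =>
    have hm : m ∉ S := fun hm => lt_irrefl _ (h m hm)
    rcases lt_trichotomy i m with him | rfl | hmi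
    · have h' : ∀ j ∈ insert m S, i < j := by
        intro j hj
        rcases Finset.mem_insert.1 hj with rfl | hj
        exacts [him, him.trans (h j hj)]
      rw [if_neg fun hi => lt_irrefl _ (h' i hi), D.mono_insert h', sgn,
        Finset.filter_eq_empty_iff.2 fun j hj => (h' j hj).not_gt]
      simp
    · rw [if_pos (Finset.mem_insert_self _ _), D.mono_insert h, ← mul_assoc, gen, D.vec_mul_self,
        zero_mul]
    · rw [D.mono_insert h, ← mul_assoc, gen_mul_gen, smul_mul_assoc, mul_assoc, ih]
      simp only [Finset.mem_insert, hmi.ne', false_or]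
      split_ifs with hi
      · simp
      · have h' : ∀ j ∈ insert i S, m < j := by
          intro j hj
          rcases Finset.mem_insert.1 hj with rfl | hj
          exacts [hmi, h j hj]
        rw [Finset.insert_comm, D.mono_insert h', mul_smul_comm, smul_smul, sgn, sgn,
          Finset.filter_insert, if_pos hmi, Finset.prod_insert (by simp [hm])]

/-! ### The monomial basis -/

/-- The space with a basis indexed by the monomials. -/
abbrev Model : Type _ := (Finset (Fin D.dim) × G) →₀ k

/-- The action of `a ∈ G` on the model. -/
noncomputable def modelGrp : G →* Module.End k D.Model where
  toFun a := Finsupp.linearCombination k fun p : Finset (Fin D.dim) × G =>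
    Finsupp.single (p.1, a * p.2) (D.F (D.deg p.1) a : k)
  map_one' := by
    ext p : 2
    simp [Module.End.one_eq_id]
  map_mul' a b := by
    ext p : 2
    simp only [Module.End.mul_eq_comp, LinearMap.comp_apply, Finsupp.lsingle_apply,
      Finsupp.linearCombination_single, one_smul, map_mul, Units.val_mul, mul_assoc,
      Finsupp.smul_single, smul_eq_mul]
    simp [mul_comm]

theorem modelGrp_single (a : G) (S : Finset (Fin D.dim)) (b : G) (c : k) :
    D.modelGrp a (Finsupp.single (S, b) c) =
      Finsupp.single (S, a * b) (c * D.F (D.deg S) a) := by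
  simp [modelGrp]

/-- The action of the `i`-th basis vector on the model. -/
noncomputable def modelGen (i : Fin D.dim) : Module.End k D.Model :=
  Finsupp.linearCombination k fun p : Finset (Fin D.dim) × G =>
    if i ∈ p.1 then 0 else Finsupp.single (insert i p.1, p.2) (D.sgn i p.1)

theorem modelGen_single (i : Fin D.dim) (S : Finset (Fin D.dim)) (b : G) (c : k) :
    D.modelGen i (Finsupp.single (S, b) c) =
      if i ∈ S then 0 else Finsupp.single (insert i S, b) (c * D.sgn i S) := by
  simp [modelGen]

theorem sgn_insert_of_lt {i j : Fin D.dim} {S : Finset (Fin D.dim)} (hij : i < j) :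
    D.sgn i (insert j S) = D.sgn i S := by
  rw [sgn, Finset.filter_insert, if_neg hij.not_gt]; rfl

theorem sgn_insert_of_gt {i j : Fin D.dim} {S : Finset (Fin D.dim)} (hij : j < i) (hj : j ∉ S) :
    D.sgn i (insert j S) = (D.F (D.wt j).1 (D.wt i).1 : k) * D.sgn i S := by
  rw [sgn, Finset.filter_insert, if_pos hij, Finset.prod_insert (by simp [hj])]; rfl

/-- For distinct `i`, `j` outside `S`, the two orders of insertion differ only in the factor of the
pair `i`, `j` itself, which is present in just one of them. For `i < j` it has to be inverted by
skew symmetry, for `j < i` it is the required scalar. For `i = j` both sides vanish. -/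
theorem modelGen_mul_modelGen (i j : Fin D.dim) :
    D.modelGen i * D.modelGen j =
      (D.F (D.wt j).1 (D.wt i).1 : k) • (D.modelGen j * D.modelGen i) := by
  ext ⟨S, b⟩ : 2
  simp only [LinearMap.comp_apply, Finsupp.lsingle_apply, Module.End.mul_apply,
    LinearMap.smul_apply, modelGen_single]
  by_cases hi : i ∈ S <;> by_cases hj : j ∈ S
  · simp [hi, hj]
  · simp [hi, hj, modelGen_single]
  · simp [hi, hj, modelGen_single]
  · rw [if_neg hi, if_neg hj, modelGen_single, modelGen_single]
    rcases lt_trichotomy i j with h | rfl | h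
    · rw [if_neg (by simp [hi, h.ne]), if_neg (by simp [hj, h.ne']), Finset.insert_comm,
        D.sgn_insert_of_lt h, D.sgn_insert_of_gt h hi, Finsupp.smul_single, smul_eq_mul]
      congr 1
      linear_combination (-D.sgn i S * D.sgn j S) * D.F_mul_swap (D.wt i).1 (D.wt j).1
    · simp
    · rw [if_neg (by simp [hi, h.ne']), if_neg (by simp [hj, h.ne]), Finset.insert_comm,
        D.sgn_insert_of_lt h, D.sgn_insert_of_gt h hj, Finsupp.smul_single, smul_eq_mul]
      congr 1
      ring

theorem modelGen_mul_modelGrp (i : Fin D.dim) (a : G) :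
    D.modelGen i * D.modelGrp a = (D.F a (D.wt i).1 : k) • (D.modelGrp a * D.modelGen i) := by
  ext ⟨S, b⟩ : 2
  simp only [LinearMap.comp_apply, Finsupp.lsingle_apply, Module.End.mul_apply,
    LinearMap.smul_apply, modelGen_single, modelGrp_single]
  split_ifs with h
  · simp
  · rw [modelGrp_single, D.deg_insert h]
    simp only [Finsupp.smul_single, smul_eq_mul, map_mul, MonoidHom.mul_apply, Units.val_mul]
    congr 1
    linear_combination (-D.sgn i S * D.F (D.deg S) a) * D.F_mul_swap a (D.wt i).1

/-- The action of `V_g` on the model. -/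
noncomputable def modelVec (g : D.I) : D.V g →ₗ[k] Module.End k D.Model :=
  Fintype.linearCombination k fun i => D.modelGen (D.idx.symm ⟨g, i⟩)

theorem modelVec_apply (g : D.I) (x : D.V g) :
    D.modelVec g x = ∑ i, x i • D.modelGen (D.idx.symm ⟨g, i⟩) := rfl

theorem modelVec_mul_modelVec (g h : D.I) (x : D.V g) (y : D.V h) :
    D.modelVec g x * D.modelVec h y =
      (D.F h.1 g.1 : k) • (D.modelVec h y * D.modelVec g x) := by
  simp only [modelVec_apply, Finset.sum_mul_sum, Finset.smul_sum]
  rw [Finset.sum_comm]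
  refine Finset.sum_congr rfl fun j _ => Finset.sum_congr rfl fun i _ => ?_
  simp only [smul_mul_assoc, mul_smul_comm]
  rw [modelGen_mul_modelGen, wt_symm, wt_symm]
  simp only [smul_smul]
  congr 1
  ring

theorem modelVec_mul_modelGrp (g : D.I) (x : D.V g) (a : G) :
    D.modelVec g x * D.modelGrp a = (D.F a g.1 : k) • (D.modelGrp a * D.modelVec g x) := by
  simp only [modelVec_apply, Finset.sum_mul, Finset.mul_sum, Finset.smul_sum]
  refine Finset.sum_congr rfl fun j _ => ?_
  simp only [smul_mul_assoc, mul_smul_comm]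
  rw [modelGen_mul_modelGrp, wt_symm, smul_comm]

/-- The action of `H(D)` on the model. -/
noncomputable def modelHom : D.H →ₐ[k] Module.End k D.Model :=
  D.lift (A := Module.End k D.Model) D.modelGrp D.modelVec D.modelVec_mul_modelVec
    D.modelVec_mul_modelGrp

theorem modelHom_grp (a : G) : D.modelHom (D.grp a) = D.modelGrp a := D.lift_grp _ _ _ _ a

theorem modelHom_gen (i : Fin D.dim) : D.modelHom (D.gen i) = D.modelGen i := by
  rw [gen, modelHom, lift_vec, modelVec_apply]
  simp [Pi.single_apply]

/-- The linear map that sends the basis of the model to the monomials. -/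
noncomputable def ofModel : D.Model →ₗ[k] D.H :=
  Finsupp.linearCombination k fun p => D.mono p.1 * D.grp p.2

theorem ofModel_single (S : Finset (Fin D.dim)) (a : G) (c : k) :
    D.ofModel (Finsupp.single (S, a) c) = c • (D.mono S * D.grp a) := by
  simp [ofModel]

/-- `ofModel` is a map of `H(D)`-modules. Evaluated at the vector `(∅, 1)`, which goes to `1`, this
says that every `h` is a combination of monomials. -/
theorem ofModel_modelHom [CharZero k] (h : D.H) (m : D.Model) :
    D.ofModel (D.modelHom h m) = h * D.ofModel m := by
  have gen_case : ∀ i m, D.ofModel (D.modelHom (D.gen i) m) = D.gen i * D.ofModel m := by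
    intro i m
    rw [modelHom_gen]
    induction m using Finsupp.induction_linear with
    | zero => simp
    | add x y hx hy => simp only [map_add, hx, hy, mul_add]
    | single p c =>
      obtain ⟨S, b⟩ := p
      rw [modelGen_single, ofModel_single, mul_smul_comm, ← mul_assoc, gen_mul_mono]
      split_ifs
      · simp
      · rw [ofModel_single, smul_mul_assoc, smul_smul]
  induction h using D.induction generalizing m with
  | hgrp a =>
    rw [modelHom_grp]
    induction m using Finsupp.induction_linear with
    | zero => simp
    | add x y hx hy => simp only [map_add, hx, hy, mul_add]
    | single p c =>
      obtain ⟨S, b⟩ := p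
      rw [modelGrp_single, ofModel_single, ofModel_single, mul_smul_comm, ← mul_assoc,
        grp_mul_mono, smul_mul_assoc, mul_assoc, map_mul, smul_smul]
  | hvec g x =>
    rw [vec_eq_sum]
    simp only [map_sum, map_smul, LinearMap.sum_apply, LinearMap.smul_apply, gen_case,
      Finset.sum_mul, smul_mul_assoc]
  | hscal c => simp [Algebra.smul_def]
  | hadd x y hx hy => simp only [map_add, LinearMap.add_apply, hx, hy, add_mul]
  | hmul x y hx hy => rw [map_mul, Module.End.mul_apply, hx, hy, mul_assoc]

/-- No sign appears: the generators act from the largest to the smallest, so each has nothing below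
it to pass. This is the source of linear independence. -/
theorem modelHom_mono (S : Finset (Fin D.dim)) (a : G) :
    D.modelHom (D.mono S) (Finsupp.single (∅, a) 1) = Finsupp.single (S, a) 1 := by
  induction S using Finset.induction_on_min with
  | empty => simp
  | insert i S h ih =>
    rw [D.mono_insert h, map_mul, Module.End.mul_apply, ih, modelHom_gen, modelGen_single,
      if_neg fun hi => lt_irrefl _ (h i hi), sgn,
      Finset.filter_eq_empty_iff.2 fun j hj => (h j hj).not_gt, Finset.prod_empty, mul_one]

variable [CharZero k]

/-- `H(D)` has the monomials `x_S a` as a basis. -/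
noncomputable def modelEquiv : D.H ≃ₗ[k] D.Model :=
  LinearEquiv.ofLinearMap (LinearMap.applyₗ (Finsupp.single (∅, 1) 1) ∘ₗ D.modelHom.toLinearMap)
    D.ofModel
    (by
      -- Independence: `x_S a` sends `(∅, 1)` to `(S, a)`.
      ext ⟨S, a⟩ : 2
      simp [ofModel_single, modelHom_mono, modelHom_grp, modelGrp_single])
    (by
      -- Spanning: `ofModel` sends `h · (∅, 1)` to `h · 1`.
      ext h
      simp [ofModel_modelHom, ofModel_single])

/-- The basis of `H(D)` that consists of the monomials `x_S a`. -/
noncomputable def pbw : Module.Basis (Finset (Fin D.dim) × G) k D.H := .ofRepr D.modelEquiv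

@[simp] theorem pbw_apply (p : Finset (Fin D.dim) × G) : D.pbw p = D.mono p.1 * D.grp p.2 := by
  change D.modelEquiv.symm (Finsupp.single p 1) = _
  change D.ofModel _ = _
  rw [ofModel_single, one_smul]

end Monomials

end Datum

namespace Datum

variable {k G : Type*} [Field k] [CommGroup G] (D : Datum k G) [Finite G]

/-! ### The comultiplication of the monomials -/

theorem comul_gen (i : Fin D.dim) :
    Coalgebra.comul (R := k) (D.gen i) =
      D.gen i ⊗ₜ 1 + D.grp (D.wt i).1 ⊗ₜ D.gen i := D.comul_vec _ _

/-- In the product of the `x_i ⊗ 1 + g_i ⊗ x_i`, the set `T` records the factors from which the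
first summand is taken. The exact scalars are never needed, only that they are invertible, hence the
values in `kˣ`. -/
theorem exists_comul_mono (S : Finset (Fin D.dim)) :
    ∃ l : Finset (Fin D.dim) → kˣ, Coalgebra.comul (R := k) (D.mono S) =
      ∑ T ∈ S.powerset, (l T : k) • ((D.mono T * D.grp (D.deg (S \ T))) ⊗ₜ[k] D.mono (S \ T)) := by
  induction S using Finset.induction_on_min with
  | empty => exact ⟨1, by simp [Algebra.TensorProduct.one_def]⟩
  | insert i S h ih =>
    have hi : i ∉ S := fun hi => lt_irrefl _ (h i hi)
    obtain ⟨l, hl⟩ := ih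
    -- If `x_i` goes to the left factor it is already in place, being the least; if `g_i` does, it
    -- has to pass `x_T`, which costs `F(g_T, g_i)`.
    refine ⟨fun T => if i ∈ T then l (T.erase i) else D.F (D.deg T) (D.wt i).1 * l T, ?_⟩
    rw [D.mono_insert h, Bialgebra.comul_mul, hl, comul_gen, Finset.sum_powerset_insert hi, add_mul,
      add_comm, Finset.mul_sum, Finset.mul_sum]
    congr 1
    · refine Finset.sum_congr rfl fun T hT => ?_
      have hT := Finset.mem_powerset.1 hT
      have hiT : i ∉ T := fun h => hi (hT h)
      simp only [if_neg hiT]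
      rw [Finset.insert_sdiff_of_notMem _ hiT,
        D.mono_insert fun j hj => h j (Finset.mem_sdiff.1 hj).1,
        D.deg_insert fun h => hi (Finset.mem_sdiff.1 h).1, mul_smul_comm,
        Algebra.TensorProduct.tmul_mul_tmul, ← mul_assoc (D.grp _) (D.mono _), grp_mul_mono,
        smul_mul_assoc, ← TensorProduct.smul_tmul', smul_smul, mul_assoc (D.mono _), ← map_mul,
        Units.val_mul, mul_comm (l T : k)]
    · refine Finset.sum_congr rfl fun T hT => ?_
      have hT := Finset.mem_powerset.1 hT
      have hiT : i ∉ T := fun h => hi (hT h)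
      simp only [if_pos (Finset.mem_insert_self _ _), Finset.erase_insert hiT]
      rw [Finset.insert_sdiff_insert, Finset.sdiff_insert_of_notMem hi,
        D.mono_insert fun j hj => h j (hT hj), mul_smul_comm,
        Algebra.TensorProduct.tmul_mul_tmul, one_mul, mul_assoc]

/-- The coefficients of the comultiplication of a monomial. -/
noncomputable def comulCoef (S T : Finset (Fin D.dim)) : kˣ := (D.exists_comul_mono S).choose T

theorem comul_mono (S : Finset (Fin D.dim)) :
    Coalgebra.comul (R := k) (D.mono S) = ∑ T ∈ S.powerset,
      (D.comulCoef S T : k) • ((D.mono T * D.grp (D.deg (S \ T))) ⊗ₜ[k] D.mono (S \ T)) :=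
  (D.exists_comul_mono S).choose_spec

theorem comul_mono_mul_grp (S : Finset (Fin D.dim)) (a : G) :
    Coalgebra.comul (R := k) (D.mono S * D.grp a) = ∑ T ∈ S.powerset, (D.comulCoef S T : k) •
      ((D.mono T * D.grp (D.deg (S \ T) * a)) ⊗ₜ[k] (D.mono (S \ T) * D.grp a)) := by
  simp only [Bialgebra.comul_mul, comul_mono, comul_grp, Finset.sum_mul, smul_mul_assoc,
    Algebra.TensorProduct.tmul_mul_tmul, mul_assoc, map_mul]

theorem counit_mono {S : Finset (Fin D.dim)} (h : S.Nonempty) :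
    Coalgebra.counit (R := k) (D.mono S) = 0 := by
  induction S using Finset.induction_on_min with
  | empty => simp at h
  | insert i S h' ih => rw [D.mono_insert h', Bialgebra.counit_mul, gen, counit_vec, zero_mul]

variable [CharZero k]

open scoped Classical in
theorem pbw_repr_mono_mul_grp (S T : Finset (Fin D.dim)) (a b : G) :
    D.pbw.repr (D.mono S * D.grp a) (T, b) = if S = T ∧ a = b then 1 else 0 := by
  rw [← D.pbw_apply (S, a), Module.Basis.repr_self,
    Finsupp.single_apply]
  simp only [Prod.mk.injEq]

/-- The coordinate of an element of `H(D) ⊗ H(D)` at a pair of monomials. -/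
noncomputable def coordPair (p q : Finset (Fin D.dim) × G) : D.H ⊗[k] D.H →ₗ[k] k :=
  LinearMap.mul' k k ∘ₗ TensorProduct.map (D.pbw.coord p) (D.pbw.coord q)

@[simp] theorem coordPair_tmul (p q : Finset (Fin D.dim) × G) (x y : D.H) :
    D.coordPair p q (x ⊗ₜ y) = D.pbw.coord p x * D.pbw.coord q y := rfl

open scoped Classical in
-- The monomials `x_T b` and `x_U a` can occur together only in the coproduct of `x_{T ∪ U} a`, with
-- `T`, `U` disjoint and `b = g_U a`. So `Δ(x)` is controlled coordinate by coordinate, without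
-- cancellation.
theorem coordPair_comul (T U : Finset (Fin D.dim)) (b a : G) (x : D.H) :
    D.coordPair (T, b) (U, a) (Coalgebra.comul (R := k) x) =
      if Disjoint T U ∧ b = D.deg U * a then
        (D.comulCoef (T ∪ U) T : k) * D.pbw.coord (T ∪ U, a) x else 0 := by
  have key : D.coordPair (T, b) (U, a) ∘ₗ Coalgebra.comul =
      if Disjoint T U ∧ b = D.deg U * a then
        (D.comulCoef (T ∪ U) T : k) • D.pbw.coord (T ∪ U, a) else 0 := by
    refine D.pbw.ext fun p => ?_
    obtain ⟨S, c⟩ := p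
    rw [LinearMap.comp_apply, pbw_apply, comul_mono_mul_grp, map_sum]
    simp only [map_smul, coordPair_tmul, Module.Basis.coord_apply, pbw_repr_mono_mul_grp, smul_eq_mul]
    -- Only the summand of `T` itself can contribute, and only if its complement in `S` is `U`.
    by_cases hS : T ⊆ S ∧ S \ T = U
    · obtain ⟨hTS, rfl⟩ := hS
      rw [Finset.sum_eq_single T (fun T' _ h => by simp [h])
        (fun h => absurd (Finset.mem_powerset.2 hTS) h), Finset.union_sdiff_of_subset hTS]
      by_cases hc : c = a
      · subst hc
        simp [Finset.disjoint_sdiff, pbw_repr_mono_mul_grp, apply_ite (fun f : D.H →ₗ[k] k =>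
          f (D.mono S * D.grp c)), eq_comm]
      · simp [hc, apply_ite (fun f : D.H →ₗ[k] k => f (D.mono S * D.grp c)),
          pbw_repr_mono_mul_grp]
    · rw [Finset.sum_eq_zero]
      · split_ifs with h
        · have : S ≠ T ∪ U := by
            rintro rfl
            exact hS ⟨Finset.subset_union_left, Finset.union_sdiff_cancel_left h.1⟩
          simp [pbw_repr_mono_mul_grp, this]
        · rfl
      · intro T' hT'
        by_cases h : T' = T
        · subst h
          have : S \ T' ≠ U := fun h => hS ⟨Finset.mem_powerset.1 hT', h⟩
          simp [this]
        · simp [h]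
  have := LinearMap.congr_fun key x
  rw [LinearMap.comp_apply] at this
  rw [this]
  split_ifs <;> simp

theorem coordPair_comul_of_disjoint {T U : Finset (Fin D.dim)} (h : Disjoint T U) (a : G) (x : D.H) :
    D.coordPair (T, D.deg U * a) (U, a) (Coalgebra.comul (R := k) x) =
        (D.comulCoef (T ∪ U) T : k) * D.pbw.coord (T ∪ U, a) x := by
  rw [coordPair_comul, if_pos ⟨h, rfl⟩]

end Datum

/-! ### Slices of subcoalgebras -/

/-- As `Δ(x)` lies in `C ⊗ C`, evaluating its right factor leaves an element of `C`. This produces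
explicit elements of a subcoalgebra. -/
theorem IsSubcoalgebra.slice_mem {k A : Type*} [Field k] [AddCommGroup A] [Module k A]
    [Coalgebra k A] {C : Submodule k A} (hC : IsSubcoalgebra C) {x : A} (hx : x ∈ C)
    (f : A →ₗ[k] k) :
    TensorProduct.rid k A (LinearMap.lTensor A f (Coalgebra.comul (R := k) x)) ∈ C := by
  obtain ⟨z, hz⟩ := hC x hx
  rw [← hz]
  clear hz
  induction z with
  | zero => simp
  | add y z hy hz => simpa only [map_add] using C.add_mem hy hz
  | tmul y z => simpa using C.smul_mem _ y.2

theorem isSubcoalgebra_span_singleton {k A : Type*} [Field k] [AddCommGroup A] [Module k A]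
    [Coalgebra k A] {x : A} (hx : Coalgebra.comul (R := k) x = x ⊗ₜ x) :
    IsSubcoalgebra (Submodule.span k {x}) := by
  intro y hy
  obtain ⟨c, rfl⟩ := Submodule.mem_span_singleton.1 hy
  refine ⟨c • (⟨x, Submodule.mem_span_singleton_self x⟩ ⊗ₜ ⟨x, Submodule.mem_span_singleton_self x⟩),
    ?_⟩
  rw [map_smul, map_smul, hx, TensorProduct.map_tmul]
  rfl

/-! ### Spans of grouplikes, and skew primitive elements that are visible from the generators -/

namespace Datum

variable {k G : Type*} [Field k] [CommGroup G] (D : Datum k G)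

theorem grp_ne_zero (a : G) : D.grp a ≠ 0 := by
  intro h
  have := D.counit_grp a
  rw [h, map_zero] at this
  exact zero_ne_one this

theorem kG_eq_span : D.kG = Submodule.span k (Set.range D.grp) := by
  apply le_antisymm
  · rintro _ ⟨x, rfl⟩
    induction x using MonoidAlgebra.induction_linear with
    | zero => simp
    | add x y hx hy => rw [map_add]; exact add_mem hx hy
    | single a c =>
      rw [AlgHom.toLinearMap_apply, groupAlg, MonoidAlgebra.lift_single]
      exact Submodule.smul_mem _ _ (Submodule.subset_span ⟨a, rfl⟩)
  · rw [Submodule.span_le]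
    rintro _ ⟨a, rfl⟩
    exact ⟨MonoidAlgebra.single a 1, by simp [groupAlg]⟩

theorem grp_mem_kG (a : G) : D.grp a ∈ D.kG := by
  rw [kG_eq_span]; exact Submodule.subset_span ⟨a, rfl⟩

theorem vec_mem_vecSum (g : D.I) (x : D.V g) : D.vec g x ∈ D.vecSum :=
  Submodule.mem_iSup_of_mem g ⟨x, rfl⟩

theorem isSimpleSubcoalgebra_span_grp (a : G) :
    IsSimpleSubcoalgebra (Submodule.span k {D.grp a}) :=
  ⟨isSubcoalgebra_span_singleton (D.comul_grp a), by simpa using D.grp_ne_zero a,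
    fun _ _ h => (nonzero_span_atom _ (D.grp_ne_zero a)).le_iff.1 h⟩

theorem map_mulLeft_vecSpace_le (a g : G) :
    (D.vecSpace g).map (LinearMap.mulLeft k (D.grp a)) ≤ D.kG * D.vecSum := by
  rw [Submodule.map_le_iff_le_comap]
  refine iSup_le fun h => ?_
  rintro _ ⟨x, rfl⟩
  exact Submodule.mul_mem_mul (D.grp_mem_kG a) (D.vec_mem_vecSum _ _)

theorem grp_mul_vec_mem_skewPrimitives (a : G) (g : D.I) (x : D.V g) :
    D.grp a * D.vec g x ∈ skewPrimitives k (D.grp a) (D.grp (a * g.1)) := by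
  change Coalgebra.comul (R := k) _ = _
  rw [Bialgebra.comul_mul, comul_grp, comul_vec, mul_add,
    Algebra.TensorProduct.tmul_mul_tmul, Algebra.TensorProduct.tmul_mul_tmul, mul_one, map_mul]

theorem sub_mem_skewPrimitives (a b : G) :
    D.grp a - D.grp b ∈ skewPrimitives k (D.grp a) (D.grp b) := by
  change Coalgebra.comul (R := k) _ = _
  rw [map_sub, comul_grp, comul_grp, TensorProduct.sub_tmul, TensorProduct.tmul_sub]
  abel

theorem map_mulLeft_vecSpace_le_skewPrimitives (a b : G) :
    (D.vecSpace (a⁻¹ * b)).map (LinearMap.mulLeft k (D.grp a)) ≤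
      skewPrimitives k (D.grp a) (D.grp b) := by
  rw [Submodule.map_le_iff_le_comap]
  refine iSup_le fun h => ?_
  rintro _ ⟨x, rfl⟩
  have := D.grp_mul_vec_mem_skewPrimitives a ⟨_, h⟩ x
  rwa [mul_inv_cancel_left] at this

/-- Applying `ε ⊗ id` to `Δ(x) = x ⊗ a + b ⊗ x` gives `x = ε(x) a + x`, and `a ≠ 0`. -/
theorem counit_of_mem_skewPrimitives {a b : G} {x : D.H}
    (hx : x ∈ skewPrimitives k (D.grp a) (D.grp b)) : Coalgebra.counit (R := k) x = 0 := by
  have h := congrArg (TensorProduct.lid k D.H) (congrArg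
    (LinearMap.rTensor D.H (Coalgebra.counit (R := k)))
    (show Coalgebra.comul (R := k) x = _ from hx))
  rw [Coalgebra.rTensor_counit_comul, map_add, map_add] at h
  simp only [LinearMap.rTensor_tmul, TensorProduct.lid_tmul, counit_grp, one_smul] at h
  exact (smul_eq_zero.1 (right_eq_add.1 h)).resolve_right (D.grp_ne_zero a)

variable [Finite G]

theorem gen_mem_vecSpace (i : Fin D.dim) : D.gen i ∈ D.vecSpace (D.wt i).1 :=
  Submodule.mem_iSup_of_mem (D.wt i).2 (D.gen_mem_range i)

theorem gen_mem_vecSum (i : Fin D.dim) : D.gen i ∈ D.vecSum := D.vec_mem_vecSum _ _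

theorem vecSum_eq_span : D.vecSum = Submodule.span k (Set.range D.gen) := by
  apply le_antisymm
  · refine iSup_le fun g => ?_
    rintro _ ⟨x, rfl⟩
    rw [vec_eq_sum]
    exact Submodule.sum_mem _ fun i _ => Submodule.smul_mem _ _ (Submodule.subset_span ⟨_, rfl⟩)
  · rw [Submodule.span_le]
    rintro _ ⟨i, rfl⟩
    exact D.gen_mem_vecSum i

variable [CharZero k]

/-! ### The coradical and the grouplike elements -/

open scoped Classical in
theorem pbw_repr_grp (S : Finset (Fin D.dim)) (a b : G) :
    D.pbw.repr (D.grp a) (S, b) = if S = ∅ ∧ a = b then 1 else 0 := by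
  have := D.pbw_repr_mono_mul_grp ∅ S a b
  rw [mono_empty, one_mul] at this
  rw [this]
  simp only [eq_comm]

theorem coord_slice (p q : Finset (Fin D.dim) × G) (z : D.H ⊗[k] D.H) :
    D.pbw.coord p (TensorProduct.rid k D.H (LinearMap.lTensor D.H (D.pbw.coord q) z)) =
      D.coordPair p q z := by
  induction z with
  | zero => simp
  | add y z hy hz => simp only [map_add, hy, hz]
  | tmul y z => simp [mul_comm]

/-- Evaluate the right factor of `Δ(x)` at a longest monomial `x_S a` of `x`. A nontrivial left part
`x_T` would come from the longer monomial `x_{T ∪ S} a`, so only an invertible multiple of `g_S a`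
survives. -/
theorem exists_grp_mem {C : Submodule k D.H} (hC : IsSubcoalgebra C) (h : C ≠ ⊥) :
    ∃ a, D.grp a ∈ C := by
  classical
  obtain ⟨x, hx, hx0⟩ := Submodule.exists_mem_ne_zero_of_ne_bot h
  have hs : (D.pbw.repr x).support.Nonempty := by
    rw [Finsupp.support_nonempty_iff]
    simpa using hx0
  obtain ⟨⟨S, a⟩, hp, hmax⟩ := Finset.exists_max_image _ (fun p => p.1.card) hs
  have hy := hC.slice_mem hx (D.pbw.coord (S, a))
  have hc := Finsupp.mem_support_iff.1 hp
  have e : TensorProduct.rid k D.H (LinearMap.lTensor D.H (D.pbw.coord (S, a))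
      (Coalgebra.comul (R := k) x)) =
      ((D.comulCoef S ∅ : k) * D.pbw.repr x (S, a)) • D.grp (D.deg S * a) := by
    refine D.pbw.ext_elem fun ⟨T, b⟩ => ?_
    rw [← Module.Basis.coord_apply, coord_slice, coordPair_comul, map_smul, Finsupp.smul_apply,
      pbw_repr_grp]
    by_cases hT : T = ∅
    · subst hT
      by_cases hb : b = D.deg S * a
      · simp [hb]
      · simp [hb, Ne.symm hb]
    · rw [if_neg (fun h : T = ∅ ∧ _ => hT h.1), smul_zero]
      split_ifs with h
      -- Disjointness makes `T ∪ S` strictly larger than `S`, against maximality.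
      · have : (T ∪ S, a) ∉ (D.pbw.repr x).support := by
          intro hm
          have : (T ∪ S).card ≤ S.card := hmax _ hm
          rw [Finset.card_union_of_disjoint h.1] at this
          have := Finset.card_pos.2 (Finset.nonempty_iff_ne_empty.2 hT)
          omega
        rw [Module.Basis.coord_apply, Finsupp.notMem_support_iff.1 this, mul_zero]
      · rfl
  rw [e] at hy
  exact ⟨_, (Submodule.smul_mem_iff _ (mul_ne_zero (Units.ne_zero _) hc)).1 hy⟩

theorem eq_span_of_isSimpleSubcoalgebra {C : Submodule k D.H} (hC : IsSimpleSubcoalgebra C) :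
    ∃ a, C = Submodule.span k {D.grp a} := by
  obtain ⟨a, ha⟩ := D.exists_grp_mem hC.1 hC.2.1
  refine ⟨a, ((hC.2.2 _ (isSubcoalgebra_span_singleton (D.comul_grp a)) ?_).resolve_left ?_).symm⟩
  · rwa [Submodule.span_singleton_le_iff_mem]
  · simpa using D.grp_ne_zero a

theorem isPointedCoalgebra : IsPointedCoalgebra k D.H := by
  intro C hC
  obtain ⟨a, rfl⟩ := D.eq_span_of_isSimpleSubcoalgebra hC
  exact finrank_span_singleton (D.grp_ne_zero a)

theorem coradical_eq : coradical k D.H = D.kG := by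
  apply le_antisymm
  · refine sSup_le fun C hC => ?_
    obtain ⟨a, rfl⟩ := D.eq_span_of_isSimpleSubcoalgebra hC
    rw [Submodule.span_singleton_le_iff_mem]
    exact D.grp_mem_kG a
  · rw [kG_eq_span, Submodule.span_le]
    rintro _ ⟨a, rfl⟩
    exact (le_sSup (D.isSimpleSubcoalgebra_span_grp a) : _ ≤ coradical k D.H)
      (Submodule.mem_span_singleton_self _)

theorem grp_injective : Function.Injective D.grp := by
  intro a b h
  classical
  have := D.pbw_repr_grp ∅ a b
  rw [h, pbw_repr_grp] at this
  by_contra hab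
  simp [hab] at this

theorem toGroupLike_bijective : Function.Bijective D.toGroupLike := by
  constructor
  · intro a b h
    exact D.grp_injective (congrArg GroupLike.val h)
  · rintro ⟨x, hx⟩
    have hx0 : x ≠ 0 := hx.ne_zero
    -- The line through a grouplike element is a subcoalgebra, so it contains some `a ∈ G`; the
    -- counit then fixes the scalar to be `1`.
    obtain ⟨a, ha⟩ := D.exists_grp_mem
      (isSubcoalgebra_span_singleton (k := k) hx.comul_eq_tmul_self) (by simpa using hx0)
    obtain ⟨c, hc⟩ := Submodule.mem_span_singleton.1 ha
    have hc1 := congrArg (Coalgebra.counit (R := k)) hc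
    rw [map_smul, hx.counit_eq_one, counit_grp, smul_eq_mul, mul_one] at hc1
    rw [hc1, one_smul] at hc
    exact ⟨a, GroupLike.val_injective hc.symm⟩

/-! ### The first term of the coradical filtration -/

theorem kG_eq_span_pbw : D.kG = Submodule.span k (D.pbw '' {p | p.1 = ∅}) := by
  rw [kG_eq_span]
  congr 1
  ext x
  constructor
  · rintro ⟨a, rfl⟩
    exact ⟨(∅, a), rfl, by simp⟩
  · rintro ⟨⟨S, a⟩, rfl, rfl⟩
    exact ⟨a, by simp⟩

/-- With this and `kG_eq_span_pbw`, the two summands of `H(D)₁` are the spans of the monomials of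
length `0` and `1`, so that membership and directness become statements about supports. -/
theorem kG_mul_vecSum_eq_span_pbw :
    D.kG * D.vecSum = Submodule.span k (D.pbw '' {p | p.1.card = 1}) := by
  apply le_antisymm
  · rw [kG_eq_span, vecSum_eq_span, Submodule.span_mul_span, Submodule.span_le]
    rintro _ ⟨_, ⟨a, rfl⟩, _, ⟨i, rfl⟩, rfl⟩
    change D.grp a * D.gen i ∈ _
    rw [grp_mul_gen]
    exact Submodule.smul_mem _ _ (Submodule.subset_span ⟨({i}, a), by simp, by
      simp [mono_singleton]⟩)
  · rw [Submodule.span_le]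
    rintro _ ⟨⟨S, a⟩, hS, rfl⟩
    obtain ⟨i, rfl⟩ := Finset.card_eq_one.1 hS
    rw [pbw_apply, mono_singleton, gen_mul_grp]
    exact Submodule.smul_mem _ _ (Submodule.mul_mem_mul (D.grp_mem_kG a) (D.gen_mem_vecSum i))

theorem disjoint_kG_kG_mul_vecSum : Disjoint D.kG (D.kG * D.vecSum) := by
  rw [kG_mul_vecSum_eq_span_pbw, kG_eq_span_pbw]
  refine D.pbw.linearIndependent.disjoint_span_image ?_
  rw [Set.disjoint_left]
  rintro ⟨S, a⟩ h h'
  simp only [Set.mem_ofPred_eq] at h h'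
  simp [h] at h'

theorem coord_eq_zero_of_mem_kG {x : D.H} (hx : x ∈ D.kG) {p : Finset (Fin D.dim) × G}
    (hp : p.1 ≠ ∅) : D.pbw.coord p x = 0 := by
  rw [kG_eq_span_pbw, Module.Basis.mem_span_image] at hx
  rw [Module.Basis.coord_apply]
  by_contra h
  exact hp (hx (Finsupp.mem_support_iff.2 h))

/-- If `S` has at least two elements, split it into `{i}` and the nonempty rest. The corresponding
coordinate vanishes on `H ⊗ k[G] + k[G] ⊗ H`, since elements of `k[G]` have no coordinates at
nonempty sets, and it is an invertible multiple of the coordinate of `x` at `S`. -/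
theorem coradicalFiltration_one :
    coradicalFiltration k D.H 1 = D.kG ⊔ D.kG * D.vecSum := by
  have h1 : coradicalFiltration k D.H 1 = Submodule.comap (Coalgebra.comul (R := k) (A := D.H))
      (LinearMap.range (LinearMap.lTensor D.H D.kG.subtype) ⊔
        LinearMap.range (LinearMap.rTensor D.H D.kG.subtype)) := by
    rw [← coradical_eq]; rfl
  rw [h1]
  apply le_antisymm
  · rw [show D.kG ⊔ D.kG * D.vecSum =
      Submodule.span k (D.pbw '' ({p | p.1 = ∅} ∪ {p | p.1.card = 1})) by
        rw [kG_mul_vecSum_eq_span_pbw, kG_eq_span_pbw, ← Submodule.span_union, ← Set.image_union]]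
    intro x hx
    rw [Module.Basis.mem_span_image]
    rintro ⟨S, a⟩ hS
    by_contra hcard
    simp only [Set.mem_union, Set.mem_ofPred_eq, not_or] at hcard
    obtain ⟨i, hi⟩ := Finset.nonempty_iff_ne_empty.2 hcard.1
    have hne : S \ {i} ≠ ∅ := by
      intro h
      rw [Finset.sdiff_eq_empty_iff_subset, Finset.subset_singleton_iff] at h
      rcases h with h | h
      · exact hcard.1 h
      · exact hcard.2 (by rw [h]; simp)
    have e := D.coordPair_comul_of_disjoint (T := {i}) (U := S \ {i}) Finset.disjoint_sdiff a x
    rw [Finset.union_sdiff_of_subset (by simpa using hi)] at e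
    have hz : ∀ z ∈ LinearMap.range (LinearMap.lTensor D.H D.kG.subtype) ⊔
        LinearMap.range (LinearMap.rTensor D.H D.kG.subtype),
        D.coordPair ({i}, D.deg (S \ {i}) * a) (S \ {i}, a) z = 0 := by
      intro z hz
      change z ∈ LinearMap.ker _
      refine (sup_le ?_ ?_ :
        LinearMap.range (LinearMap.lTensor D.H D.kG.subtype) ⊔
          LinearMap.range (LinearMap.rTensor D.H D.kG.subtype) ≤ _) hz
      · rintro _ ⟨w, rfl⟩
        rw [LinearMap.mem_ker]
        induction w with
        | zero => simp
        | add y z hy hz => simp only [map_add, hy, hz, add_zero]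
        | tmul y z =>
          rw [LinearMap.lTensor_tmul, coordPair_tmul, Submodule.subtype_apply,
            D.coord_eq_zero_of_mem_kG z.2 hne, mul_zero]
      · rintro _ ⟨w, rfl⟩
        rw [LinearMap.mem_ker]
        induction w with
        | zero => simp
        | add y z hy hz => simp only [map_add, hy, hz, add_zero]
        | tmul y z =>
          rw [LinearMap.rTensor_tmul, coordPair_tmul, Submodule.subtype_apply,
            D.coord_eq_zero_of_mem_kG y.2 (by simp), zero_mul]
    rw [hz _ hx] at e
    exact Finsupp.mem_support_iff.1 hS
      ((mul_eq_zero.1 e.symm).resolve_left (Units.ne_zero _))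
  · refine sup_le ?_ ?_
    · refine D.kG_eq_span.le.trans (Submodule.span_le.2 ?_)
      rintro _ ⟨a, rfl⟩
      rw [SetLike.mem_coe, Submodule.mem_comap, comul_grp]
      exact Submodule.mem_sup_left ⟨D.grp a ⊗ₜ ⟨D.grp a, D.grp_mem_kG a⟩, rfl⟩
    · rw [Submodule.mul_le]
      intro u hu v hv
      rw [kG_eq_span] at hu
      rw [vecSum_eq_span] at hv
      rw [Submodule.mem_comap]
      induction hu, hv using Submodule.span_induction₂ with
      | zero_left => simp
      | zero_right => simp
      | add_left x y z _ _ _ hx hy => rw [add_mul, map_add]; exact add_mem hx hy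
      | add_right x y z _ _ _ hx hy => rw [mul_add, map_add]; exact add_mem hx hy
      | smul_left r x y _ _ h => rw [smul_mul_assoc, map_smul]; exact Submodule.smul_mem _ _ h
      | smul_right r x y _ _ h => rw [mul_smul_comm, map_smul]; exact Submodule.smul_mem _ _ h
      | mem_mem x y hx hy =>
        obtain ⟨a, rfl⟩ := hx
        obtain ⟨i, rfl⟩ := hy
        rw [Bialgebra.comul_mul, comul_grp, comul_gen, mul_add,
          Algebra.TensorProduct.tmul_mul_tmul, Algebra.TensorProduct.tmul_mul_tmul, mul_one,
          ← map_mul]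
        refine add_mem (Submodule.mem_sup_left ⟨_ ⊗ₜ ⟨D.grp a, D.grp_mem_kG a⟩, rfl⟩)
          (Submodule.mem_sup_right ⟨⟨D.grp (a * D.wt i), D.grp_mem_kG _⟩ ⊗ₜ _, rfl⟩)

/-! ### The spaces `V_g` and the skew primitive elements -/

open scoped Classical in
theorem pbw_repr_gen (i j : Fin D.dim) :
    D.pbw.repr (D.gen i) ({j}, 1) = if i = j then 1 else 0 := by
  have := D.pbw_repr_mono_mul_grp {i} {j} 1 1
  rw [mono_singleton, map_one, mul_one] at this
  simpa using this

theorem pbw_repr_vec (g : D.I) (x : D.V g) (i : Fin (D.n g)) :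
    D.pbw.repr (D.vec g x) ({D.idx.symm ⟨g, i⟩}, 1) = x i := by
  classical
  rw [vec_eq_sum, map_sum, Finsupp.finsetSum_apply]
  simp [pbw_repr_gen]

theorem pbw_repr_vec_of_ne {g h : D.I} (hgh : h ≠ g) (x : D.V h) (i : Fin (D.n g)) :
    D.pbw.repr (D.vec h x) ({D.idx.symm ⟨g, i⟩}, 1) = 0 := by
  classical
  rw [vec_eq_sum, map_sum, Finsupp.finsetSum_apply]
  refine Finset.sum_eq_zero fun j _ => ?_
  rw [map_smul, Finsupp.smul_apply, pbw_repr_gen, if_neg, smul_zero]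
  simp [hgh]

theorem vec_injective (g : D.I) : Function.Injective (D.vec g) := by
  intro x y h
  ext i
  rw [← D.pbw_repr_vec g x, h, pbw_repr_vec]

theorem iSupIndep_range_vec : iSupIndep fun g : D.I => LinearMap.range (D.vec g) := by
  intro g
  rw [Submodule.disjoint_def]
  rintro _ ⟨x, rfl⟩ hx
  have : x = 0 := by
    ext i
    rw [← D.pbw_repr_vec g x i]
    have : (⨆ h, ⨆ (_ : h ≠ g), LinearMap.range (D.vec h)) ≤
        LinearMap.ker (D.pbw.coord ({D.idx.symm ⟨g, i⟩}, 1)) := by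
      refine iSup₂_le fun h hgh => ?_
      rintro _ ⟨y, rfl⟩
      exact D.pbw_repr_vec_of_ne hgh y i
    exact this hx
  rw [this, map_zero]

/-- Every splitting `S = T ∪ U` gives a nonzero coordinate of `Δ(x)`, which must come from `x ⊗ a`,
forcing `U = ∅`, or from `b ⊗ x`, forcing `T = ∅`. -/
theorem support_of_mem_skewPrimitives {a b : G} {x : D.H}
    (hx : x ∈ skewPrimitives k (D.grp a) (D.grp b)) {S : Finset (Fin D.dim)} {h : G}
    (hS : D.pbw.repr x (S, h) ≠ 0) :
    (S = ∅ ∧ (h = a ∨ h = b)) ∨ ∃ i, S = {i} ∧ h = a ∧ (D.wt i).1 = a⁻¹ * b := by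
  classical
  change Coalgebra.comul (R := k) x = _ at hx
  have key : ∀ T U : Finset (Fin D.dim), Disjoint T U → T ∪ U = S →
      (U = ∅ ∧ h = a) ∨ (T = ∅ ∧ b = D.deg U * h) := by
    intro T U hTU hU
    by_contra hne
    rw [not_or] at hne
    have e := D.coordPair_comul_of_disjoint hTU h x
    simp only [hx, map_add, coordPair_tmul, Module.Basis.coord_apply, pbw_repr_grp, hU] at e
    rw [if_neg (fun h' => hne.1 ⟨h'.1, h'.2.symm⟩), if_neg hne.2, mul_zero, zero_mul,
      add_zero] at e
    exact hS ((mul_eq_zero.1 e.symm).resolve_left (Units.ne_zero _))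
  rcases S.eq_empty_or_nonempty with rfl | ⟨i, hi⟩
  · left
    have := key ∅ ∅ (Finset.disjoint_empty_left _) (by simp)
    simp only [deg_empty, one_mul, true_and] at this
    exact ⟨rfl, this.imp id Eq.symm⟩
  · right
    -- Here the left piece is nonempty, so the right one is empty: `S = {i}` and `h = a`.
    have h1 := key {i} (S \ {i}) Finset.disjoint_sdiff
      (Finset.union_sdiff_of_subset (by simpa using hi))
    simp only [Finset.singleton_ne_empty, false_and, or_false] at h1
    obtain ⟨h1, rfl⟩ := h1
    have hSi : S = {i} := by
      rw [Finset.sdiff_eq_empty_iff_subset] at h1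
      exact le_antisymm h1 (by simpa using hi)
    subst hSi
    -- The opposite splitting of the same singleton determines the degree of `x_i`.
    have h2 := key ∅ {i} (Finset.disjoint_empty_left _) (by simp)
    simp only [Finset.singleton_ne_empty, false_and, false_or, true_and] at h2
    refine ⟨i, rfl, rfl, ?_⟩
    rw [h2, deg, Finset.prod_singleton, mul_comm, mul_assoc, mul_inv_cancel, mul_one]

theorem skewPrimitives_eq (a b : G) :
    skewPrimitives k (D.grp a) (D.grp b) = Submodule.span k {D.grp a - D.grp b} ⊔
      (D.vecSpace (a⁻¹ * b)).map (LinearMap.mulLeft k (D.grp a)) := by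
  apply le_antisymm
  · intro x hx
    -- Supports alone only place the part of length `0` in the span of `a` and `b`; the counit,
    -- which kills skew primitives, then cuts this down to multiples of `a - b`.
    have hmem : x ∈ Submodule.span k {D.grp a, D.grp b} ⊔
        (D.vecSpace (a⁻¹ * b)).map (LinearMap.mulLeft k (D.grp a)) := by
      rw [← D.pbw.linearCombination_repr x, Finsupp.linearCombination_apply, Finsupp.sum]
      refine Submodule.sum_mem _ fun p hp => Submodule.smul_mem _ _ ?_
      obtain ⟨S, h⟩ := p
      rcases D.support_of_mem_skewPrimitives hx (Finsupp.mem_support_iff.1 hp) with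
        ⟨rfl, hab⟩ | ⟨i, rfl, rfl, hi⟩
      · refine Submodule.mem_sup_left (Submodule.subset_span ?_)
        rcases hab with rfl | rfl <;> simp
      · refine Submodule.mem_sup_right ?_
        rw [pbw_apply, mono_singleton, gen_mul_grp]
        refine Submodule.smul_mem _ _ ⟨D.gen i, ?_, rfl⟩
        rw [← hi]
        exact D.gen_mem_vecSpace i
    obtain ⟨y, hy, v, hv, rfl⟩ := Submodule.mem_sup.1 hmem
    obtain ⟨c, d, rfl⟩ := Submodule.mem_span_pair.1 hy
    have hv0 := D.counit_of_mem_skewPrimitives (D.map_mulLeft_vecSpace_le_skewPrimitives a b hv)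
    have hx0 := D.counit_of_mem_skewPrimitives hx
    have hcd : d = -c := by
      rw [map_add, hv0, map_add, map_smul, map_smul, counit_grp, counit_grp] at hx0
      simp only [smul_eq_mul, mul_one, add_zero] at hx0
      exact (neg_eq_of_add_eq_zero_right hx0).symm
    refine add_mem (Submodule.mem_sup_left (Submodule.mem_span_singleton.2 ⟨c, ?_⟩))
      (Submodule.mem_sup_right hv)
    rw [hcd, smul_sub, neg_smul, sub_eq_add_neg]
  · refine sup_le ?_ (D.map_mulLeft_vecSpace_le_skewPrimitives a b)
    · rw [Submodule.span_singleton_le_iff_mem]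
      exact D.sub_mem_skewPrimitives a b

theorem disjoint_span_map_vecSpace (a b : G) :
    Disjoint (Submodule.span k {D.grp a - D.grp b})
      ((D.vecSpace (a⁻¹ * b)).map (LinearMap.mulLeft k (D.grp a))) := by
  refine D.disjoint_kG_kG_mul_vecSum.mono ?_ (D.map_mulLeft_vecSpace_le _ _)
  rw [Submodule.span_singleton_le_iff_mem]
  exact sub_mem (D.grp_mem_kG a) (D.grp_mem_kG b)

end Datum

/-! ### Products of lists of submodules, and induction along a basis -/

theorem Submodule.list_ofFn_prod_le {R A : Type*} [CommSemiring R] [Semiring A] [Algebra R A]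
    {m : ℕ} (E : Fin m → Submodule R A) (P : Submodule R A)
    (h : ∀ u : Fin m → A, (∀ i, u i ∈ E i) → (List.ofFn u).prod ∈ P) :
    (List.ofFn E).prod ≤ P := by
  induction m generalizing P with
  | zero => simpa [Submodule.one_le] using h Fin.elim0 (fun i => i.elim0)
  | succ m ih =>
    rw [List.ofFn_succ, List.prod_cons, Submodule.mul_le]
    intro a ha
    -- The first factor `a` is absorbed into the target, which becomes the set of `b` with `a b ∈
    -- P`.
    refine fun b hb => ih (fun i => E i.succ) (P.comap (LinearMap.mulLeft R a)) (fun u hu => ?_) hb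
    have := h (Fin.cons a u) (Fin.cases (by simpa using ha) (by simpa using hu))
    simpa [List.ofFn_succ] using this

@[elab_as_elim]
theorem Module.Basis.induction_on {ι R M : Type*} [Semiring R] [AddCommMonoid M] [Module R M]
    (b : Module.Basis ι R M) {P : M → Prop} (x : M) (basis : ∀ i, P (b i)) (zero : P 0)
    (add : ∀ x y, P x → P y → P (x + y)) (smul : ∀ (c : R) x, P x → P (c • x)) : P x := by
  refine Submodule.span_induction (p := fun x _ => P x) ?_ zero (fun x y _ _ => add x y)
    (fun c x _ => smul c x) (b.mem_span x)
  rintro _ ⟨i, rfl⟩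
  exact basis i

namespace Datum

variable {k G : Type*} [Field k] [CommGroup G] (D : Datum k G)

/-! ### The projection onto the group algebra -/

/-- The projection `H(D) → k[G]`. -/
noncomputable def proj : D.H →ₐc[k] MonoidAlgebra k G :=
  BialgHom.ofAlgHom
    (D.lift (MonoidAlgebra.of k G) (fun _ => 0) (by simp) (by simp))
    (by apply D.algHom_ext <;> intros <;> simp)
    (by apply D.algHom_ext <;> intros <;> simp)

@[simp] theorem proj_grp (a : G) : D.proj (D.grp a) = MonoidAlgebra.single a 1 :=
  D.lift_grp _ _ _ _ a

@[simp] theorem proj_vec (g : D.I) (x : D.V g) : D.proj (D.vec g x) = 0 :=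
  D.lift_vec _ _ _ _ g x

/-- The right coaction of `k[G]` on `H(D)`, as an algebra map. -/
noncomputable def coactHom : D.H →ₐ[k] D.H ⊗[k] MonoidAlgebra k G :=
  (Algebra.TensorProduct.map (AlgHom.id k D.H) (D.proj : D.H →ₐ[k] MonoidAlgebra k G)).comp
    (Bialgebra.comulAlgHom k D.H)

theorem coactHom_grp (a : G) : D.coactHom (D.grp a) = D.grp a ⊗ₜ MonoidAlgebra.single a 1 := by
  simp [coactHom]

/-! ### Commutation of the exterior subalgebras of `H(D)` -/

section

variable [CharZero k]

/-- The image of the exterior algebra of `V_g` in `H(D)`. -/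
noncomputable def extRange (g : D.I) : Submodule k D.H :=
  LinearMap.range (D.exterior g).toLinearMap

theorem extRange_mul_self (g : D.I) : D.extRange g * D.extRange g ≤ D.extRange g := by
  rw [Submodule.mul_le]
  rintro _ ⟨x, rfl⟩ _ ⟨y, rfl⟩
  exact ⟨x * y, map_mul (D.exterior g) x y⟩

theorem one_le_extRange (g : D.I) : 1 ≤ D.extRange g :=
  Submodule.one_le.2 ⟨1, map_one (D.exterior g)⟩

theorem exterior_ι (g : D.I) (x : D.V g) :
    D.exterior g (ExteriorAlgebra.ι k x) = D.vec g x := ExteriorAlgebra.lift_ι_apply k _ _ x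

theorem range_vec_le_extRange (g : D.I) : LinearMap.range (D.vec g) ≤ D.extRange g := by
  rintro _ ⟨x, rfl⟩
  exact ⟨ExteriorAlgebra.ι k x, D.exterior_ι g x⟩

/-- Scalars are irrelevant to inclusions of subspaces, so a vector passes an exterior element one
factor at a time. The vector varies in the induction because passing the first factor replaces it by
others. -/
theorem range_vec_mul_extRange (g h : D.I) :
    LinearMap.range (D.vec g) * D.extRange h ≤ D.extRange h * LinearMap.range (D.vec g) := by
  rw [Submodule.mul_le]
  intro u hu w hw
  obtain ⟨w, rfl⟩ := hw
  rw [AlgHom.toLinearMap_apply]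
  induction w using ExteriorAlgebra.induction generalizing u with
  | algebraMap c =>
    rw [AlgHom.commutes, ← Algebra.commutes]
    exact Submodule.mul_mem_mul ⟨algebraMap k _ c, AlgHom.commutes _ _⟩ hu
  | ι y =>
    obtain ⟨x, rfl⟩ := hu
    rw [exterior_ι, vec_mul_vec]
    exact Submodule.smul_mem _ _ (Submodule.mul_mem_mul (D.range_vec_le_extRange h ⟨y, rfl⟩)
      ⟨x, rfl⟩)
  | mul w₁ w₂ h₁ h₂ =>
    rw [map_mul, ← mul_assoc]
    refine Submodule.mul_induction_on (h₁ u hu) (fun v hv u' hu' => ?_) (fun x y hx hy => ?_)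
    · rw [mul_assoc]
      have := Submodule.mul_mem_mul hv (h₂ u' hu')
      rw [← mul_assoc] at this
      exact mul_le_mul' (D.extRange_mul_self h) le_rfl this
    · rw [add_mul]; exact add_mem hx hy
  | add w₁ w₂ h₁ h₂ => rw [map_add, mul_add]; exact add_mem (h₁ u hu) (h₂ u hu)

theorem extRange_mul_extRange (g h : D.I) :
    D.extRange g * D.extRange h ≤ D.extRange h * D.extRange g := by
  rw [Submodule.mul_le]
  intro u hu w hw
  obtain ⟨u, rfl⟩ := hu
  rw [AlgHom.toLinearMap_apply]
  induction u using ExteriorAlgebra.induction generalizing w with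
  | algebraMap c =>
    rw [AlgHom.commutes, Algebra.commutes]
    exact Submodule.mul_mem_mul hw ⟨algebraMap k _ c, AlgHom.commutes _ _⟩
  | ι x =>
    rw [exterior_ι]
    exact mul_le_mul' le_rfl (D.range_vec_le_extRange g)
      (D.range_vec_mul_extRange g h (Submodule.mul_mem_mul ⟨x, rfl⟩ hw))
  | mul w₁ w₂ h₁ h₂ =>
    rw [map_mul, mul_assoc]
    refine Submodule.mul_induction_on (h₂ w hw) (fun v hv u' hu' => ?_) (fun x y hx hy => ?_)
    · rw [← mul_assoc]
      have := Submodule.mul_mem_mul (h₁ v hv) hu'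
      rw [mul_assoc] at this
      exact mul_le_mul' le_rfl (D.extRange_mul_self g) this
    · rw [mul_add]; exact add_mem hx hy
  | add w₁ w₂ h₁ h₂ => rw [map_add, add_mul]; exact add_mem (h₁ w hw) (h₂ w hw)

/-- The new factor moves right until it meets its own copy, which absorbs it since it is a
subalgebra. -/
theorem extRange_mul_prod {l : List D.I} {g : D.I} (hg : g ∈ l) :
    D.extRange g * (l.map D.extRange).prod ≤ (l.map D.extRange).prod := by
  induction l with
  | nil => simp at hg
  | cons h l ih =>
    rw [List.map_cons, List.prod_cons, ← mul_assoc]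
    by_cases hgh : g = h
    · subst hgh
      exact mul_le_mul' (D.extRange_mul_self g) le_rfl
    · refine (mul_le_mul' (D.extRange_mul_extRange g h) le_rfl).trans ?_
      rw [mul_assoc]
      exact mul_le_mul' le_rfl (ih ((List.mem_cons.1 hg).resolve_left hgh))

theorem one_le_prod_extRange (l : List D.I) : 1 ≤ (l.map D.extRange).prod := by
  induction l with
  | nil => simp
  | cons h l ih =>
    rw [List.map_cons, List.prod_cons]
    exact (one_mul (1 : Submodule k D.H)).symm.le.trans
      (mul_le_mul' (D.one_le_extRange h) ih)

end

variable [Finite G]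

/-- The dimension `∏ 2 ^ n_g` equals the number of monomials `x_S`; this count turns surjectivity of
`tensorIncl` onto their span into injectivity. -/
theorem finrank_B : Module.finrank k D.B = 2 ^ D.dim := by
  classical
  have := Fintype.ofFinite D.I
  rw [Module.finrank_eq_card_basis (Basis.piTensorProduct fun g : D.I =>
    (Pi.basisFun k (Fin (D.n g))).ExteriorAlgebra)]
  simp [Finset.prod_pow_eq_pow_sum, dim]

theorem coactHom_mono (S : Finset (Fin D.dim)) : D.coactHom (D.mono S) = D.mono S ⊗ₜ 1 := by
  induction S using Finset.induction_on_min with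
  | empty => rw [mono_empty, map_one, Algebra.TensorProduct.one_def]
  | insert i S h ih =>
    rw [D.mono_insert h, map_mul, ih]
    simp [coactHom, gen]

/-- The span of the monomials `x_S`. -/
noncomputable def monoSpan : Submodule k D.H := Submodule.span k (Set.range D.mono)

theorem mono_mem_monoSpan (S : Finset (Fin D.dim)) : D.mono S ∈ D.monoSpan :=
  Submodule.subset_span ⟨S, rfl⟩

theorem one_mem_monoSpan : (1 : D.H) ∈ D.monoSpan := D.mono_empty ▸ D.mono_mem_monoSpan ∅

variable [CharZero k]

/-- The coaction sends `x_S a` to `x_S a ⊗ a`, so coinvariance leaves only the monomials with `a =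
1`. -/
theorem coe_monoSpan : (D.monoSpan : Set D.H) = rightCoinvariants D.proj := by
  ext x
  constructor
  · intro hx
    change D.coactHom x = x ⊗ₜ 1
    refine Submodule.span_induction ?_ ?_ ?_ ?_ hx
    · rintro _ ⟨S, rfl⟩
      exact D.coactHom_mono S
    · simp
    · intro x y _ _ hx hy
      rw [map_add, hx, hy, TensorProduct.add_tmul]
    · intro c x _ hx
      rw [map_smul, hx, TensorProduct.smul_tmul']
  · intro hx
    change D.coactHom x = x ⊗ₜ 1 at hx
    classical
    -- Taking the coefficient at `1 ∈ G` fixes `x ⊗ 1`, and after the coaction it kills every `x_S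
    -- a` with `a ≠ 1`.
    let f : D.H ⊗[k] MonoidAlgebra k G →ₗ[k] D.H := (TensorProduct.rid k D.H).toLinearMap ∘ₗ
      LinearMap.lTensor D.H (Finsupp.lapply 1 ∘ₗ (MonoidAlgebra.coeffLinearEquiv k).toLinearMap)
    have hf : f (x ⊗ₜ 1) = x := by simp [f, MonoidAlgebra.one_def]
    rw [SetLike.mem_coe, ← hf, ← hx]
    clear hx hf
    induction x using D.pbw.induction_on with
    | zero => simp
    | add x y hx hy => rw [map_add, map_add]; exact add_mem hx hy
    | smul c x hx => rw [map_smul, map_smul]; exact Submodule.smul_mem _ _ hx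
    | basis p =>
      rw [pbw_apply, map_mul, coactHom_mono, coactHom_grp, Algebra.TensorProduct.tmul_mul_tmul,
        one_mul]
      by_cases h : p.2 = 1
      · simpa [f, h] using D.mono_mem_monoSpan p.1
      · simp [f, h]

/-! ### Products of monomials -/

/-- The second clause is recorded because `g_{S ∪ T} = g_S g_T` is only available for disjoint sets;
otherwise the product is zero. -/
theorem exists_mono_mul_mono (S T : Finset (Fin D.dim)) :
    ∃ c : k, D.mono S * D.mono T = c • D.mono (S ∪ T) ∧ (¬ Disjoint S T → c = 0) := by
  induction S using Finset.induction_on_min with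
  | empty => exact ⟨1, by simp, by simp⟩
  | insert i S h ih =>
    obtain ⟨c, hc, hc0⟩ := ih
    rw [D.mono_insert h, mul_assoc, hc, mul_smul_comm, gen_mul_mono]
    have hi : i ∉ S := fun hi => lt_irrefl _ (h i hi)
    by_cases hiT : i ∈ T
    · exact ⟨0, by simp [hiT], fun _ => rfl⟩
    · refine ⟨c * D.sgn i (S ∪ T), ?_, fun hd => ?_⟩
      · rw [if_neg (by simp [hi, hiT]), smul_smul, Finset.insert_union]
      · rw [hc0, zero_mul]
        rwa [Finset.disjoint_insert_left, not_and_or, not_not, or_iff_right hiT] at hd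

/-- The coefficient of the product of two monomials. -/
noncomputable def mulCoef (S T : Finset (Fin D.dim)) : k := (D.exists_mono_mul_mono S T).choose

theorem mono_mul_mono (S T : Finset (Fin D.dim)) :
    D.mono S * D.mono T = D.mulCoef S T • D.mono (S ∪ T) :=
  (D.exists_mono_mul_mono S T).choose_spec.1

theorem mulCoef_of_not_disjoint {S T : Finset (Fin D.dim)} (h : ¬ Disjoint S T) :
    D.mulCoef S T = 0 :=
  (D.exists_mono_mul_mono S T).choose_spec.2 h

/-- The span of the monomials `x_S`, as a subalgebra. -/
noncomputable def monoAlg : Subalgebra k D.H :=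
  D.monoSpan.toSubalgebra D.one_mem_monoSpan (by
    intro x y hx hy
    induction hx, hy using Submodule.span_induction₂ with
    | zero_left => simp
    | zero_right => simp
    | add_left x y z _ _ _ hx hy => rw [add_mul]; exact add_mem hx hy
    | add_right x y z _ _ _ hx hy => rw [mul_add]; exact add_mem hx hy
    | smul_left r x y _ _ h => rw [smul_mul_assoc]; exact Submodule.smul_mem _ _ h
    | smul_right r x y _ _ h => rw [mul_smul_comm]; exact Submodule.smul_mem _ _ h
    | mem_mem x y hx hy =>
      obtain ⟨S, rfl⟩ := hx
      obtain ⟨T, rfl⟩ := hy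
      rw [mono_mul_mono]
      exact Submodule.smul_mem _ _ (D.mono_mem_monoSpan _))

theorem mem_monoAlg {x : D.H} : x ∈ D.monoAlg ↔ x ∈ D.monoSpan := Iff.rfl

theorem vec_mem_monoAlg (g : D.I) (x : D.V g) : D.vec g x ∈ D.monoAlg := by
  rw [vec_eq_sum]
  exact Submodule.sum_mem D.monoSpan fun i _ =>
    Submodule.smul_mem _ _ (D.mono_singleton _ ▸ D.mono_mem_monoSpan _)

theorem exterior_mem_monoAlg (g : D.I) (w : ExteriorAlgebra k (D.V g)) :
    D.exterior g w ∈ D.monoAlg := by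
  induction w using ExteriorAlgebra.induction with
  | algebraMap c => rw [AlgHom.commutes]; exact Subalgebra.algebraMap_mem _ _
  | ι x => rw [exterior, ExteriorAlgebra.lift_ι_apply]; exact D.vec_mem_monoAlg g x
  | mul x y hx hy => rw [map_mul]; exact mul_mem hx hy
  | add x y hx hy => rw [map_add]; exact add_mem hx hy

theorem tensorIncl_mem_monoSpan {m : ℕ} (e : Fin m ≃ D.I) (w : D.B) :
    D.tensorIncl e w ∈ D.monoSpan := by
  induction w using PiTensorProduct.induction_on with
  | smul_tprod c w =>
    rw [map_smul, tensorIncl_tprod]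
    refine Submodule.smul_mem _ _ (D.mem_monoAlg.1 (Subalgebra.list_prod_mem _ ?_))
    intro x hx
    obtain ⟨i, rfl⟩ := (List.mem_ofFn' _ _).1 hx
    exact D.exterior_mem_monoAlg _ _
  | add x y hx hy => rw [map_add]; exact add_mem hx hy

/-! ### The image of the tensor product of the exterior algebras -/

theorem monoSpan_le_prod_extRange {l : List D.I} (hl : ∀ g, g ∈ l) :
    D.monoSpan ≤ (l.map D.extRange).prod := by
  rw [monoSpan, Submodule.span_le]
  rintro _ ⟨S, rfl⟩
  induction S using Finset.induction_on_min with
  | empty =>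
    rw [mono_empty]
    exact Submodule.one_le.1 (D.one_le_prod_extRange l)
  | insert i S h ih =>
    rw [D.mono_insert h]
    exact D.extRange_mul_prod (hl (D.wt i)) (Submodule.mul_mem_mul
      (D.range_vec_le_extRange _ (D.gen_mem_range i)) ih)

/-- The enumeration of the `x_i` need not agree with the ordering `e`. The comparison therefore uses
subspaces: the ordered product of the exterior subalgebras contains `1` and is stable under left
multiplication by every generator, hence contains all `x_S`. -/
theorem range_tensorIncl {m : ℕ} (e : Fin m ≃ D.I) :
    LinearMap.range (D.tensorIncl e) = D.monoSpan := by
  apply le_antisymm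
  · rintro _ ⟨w, rfl⟩
    exact D.tensorIncl_mem_monoSpan e w
  · refine (D.monoSpan_le_prod_extRange (l := List.ofFn e) fun g => ?_).trans ?_
    · exact (List.mem_ofFn' _ _).2 (e.surjective g)
    · rw [List.map_ofFn]
      refine Submodule.list_ofFn_prod_le _ _ fun u hu => ?_
      choose w hw using hu
      -- The factors are indexed by positions and the tensor by `I_F`; the cast goes along `e
      -- (e.symm g) = g`.
      refine ⟨PiTensorProduct.tprod k fun g => cast (by rw [e.apply_symm_apply]) (w (e.symm g)), ?_⟩
      rw [tensorIncl_tprod]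
      congr 2
      ext i
      rw [← hw i]
      have : ∀ (j : Fin m) (hj : j = i), D.exterior (e i)
        (cast (by rw [hj]) (w j)) = D.exterior (e i) (w i) := by
        rintro j rfl; rfl
      exact this _ (e.symm_apply_apply i)

theorem linearIndependent_mono : LinearIndependent k D.mono := by
  have := D.pbw.linearIndependent.comp (fun S : Finset (Fin D.dim) => (S, (1 : G)))
    (fun S T h => (Prod.ext_iff.1 h).1)
  convert this using 1
  ext S
  simp

theorem tensorIncl_injective {m : ℕ} (e : Fin m ≃ D.I) :
    Function.Injective (D.tensorIncl e) := by
  have : Module.Finite k D.B := Module.finite_of_finrank_pos (by rw [finrank_B]; positivity)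
  rw [← LinearMap.ker_eq_bot, ← Submodule.finrank_eq_zero]
  have h := LinearMap.finrank_range_add_finrank_ker (D.tensorIncl e)
  rw [range_tensorIncl, finrank_B, monoSpan, finrank_span_eq_card D.linearIndependent_mono,
    Fintype.card_finset, Fintype.card_fin] at h
  omega

/-- The basis of `⨂ ⋀ V_g` that corresponds to the monomials `x_S`. -/
noncomputable def tensorBasis {m : ℕ} (e : Fin m ≃ D.I) :
    Module.Basis (Finset (Fin D.dim)) k D.B :=
  (Module.Basis.span D.linearIndependent_mono).map
    ((LinearEquiv.ofInjective _ (D.tensorIncl_injective e)).trans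
      (LinearEquiv.ofEq _ _ (D.range_tensorIncl e))).symm

theorem tensorIncl_tensorBasis {m : ℕ} (e : Fin m ≃ D.I) (S : Finset (Fin D.dim)) :
    D.tensorIncl e (D.tensorBasis e S) = D.mono S := by
  have h := ((LinearEquiv.ofInjective _ (D.tensorIncl_injective e)).trans
      (LinearEquiv.ofEq _ _ (D.range_tensorIncl e))).apply_symm_apply
        (Module.Basis.span D.linearIndependent_mono S)
  replace h := congrArg Subtype.val h
  exact h.trans (congrArg Subtype.val (Module.Basis.span_apply D.linearIndependent_mono S))

end Datum

/-! ### Elementary tensors -/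

section

variable {k : Type*} [Field k] {M N P Q P' N' : Type*}
    [AddCommGroup M] [Module k M] [AddCommGroup N] [Module k N]
    [AddCommGroup P] [Module k P] [AddCommGroup Q] [Module k Q]
    [AddCommGroup P'] [Module k P'] [AddCommGroup N'] [Module k N']

/-- The twists of a biproduct send pairs of basis vectors to elementary tensors, so this case
suffices for all computations with `midMap`. -/
theorem midMap_tmul (t : N ⊗[k] P →ₗ[k] P' ⊗[k] N') (m : M) (n : N) (p : P) (q : Q) {p' : P'}
    {n' : N'} (h : t (n ⊗ₜ p) = p' ⊗ₜ n') :
    midMap k t ((m ⊗ₜ n) ⊗ₜ (p ⊗ₜ q)) = (m ⊗ₜ p') ⊗ₜ (n' ⊗ₜ q) := by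
  simp [midMap, h]

end

namespace Datum

variable {k G : Type*} [Field k] [CommGroup G] (D : Datum k G) [Finite G]
  {B : Type*} [AddCommGroup B] [Module k B] (b : Module.Basis (Finset (Fin D.dim)) k B)

/-! ### The operations of the braided Hopf algebra -/

/-- The action of `k[G]`: `a · x_S = F(g_S, a) x_S`. -/
noncomputable def ydAct : MonoidAlgebra k G ⊗[k] B →ₗ[k] B :=
  ((MonoidAlgebra.basis G k).tensorProduct b).constr k fun p => (D.F (D.deg p.2) p.1 : k) • b p.2

/-- The coaction of `k[G]`: `x_S ↦ g_S ⊗ x_S`. -/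
noncomputable def ydCoact : B →ₗ[k] MonoidAlgebra k G ⊗[k] B :=
  b.constr k fun S => MonoidAlgebra.single (D.deg S) 1 ⊗ₜ b S

/-- The braided comultiplication of the span of the `x_S`. -/
noncomputable def ydComul : B →ₗ[k] B ⊗[k] B :=
  b.constr k fun S => ∑ T ∈ S.powerset, (D.comulCoef S T : k) • (b T ⊗ₜ[k] b (S \ T))

/-- The inclusion of the span of the `x_S` in `H(D)`. -/
noncomputable def ydIncl : B →ₗ[k] D.H := b.constr k D.mono

/-- The counit of the span of the `x_S`. -/
noncomputable def ydCounit : B →ₗ[k] k := Coalgebra.counit ∘ₗ D.ydIncl b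

theorem ydAct_single (a : G) (S : Finset (Fin D.dim)) :
    D.ydAct b (MonoidAlgebra.single a 1 ⊗ₜ b S) = (D.F (D.deg S) a : k) • b S := by
  have := ((MonoidAlgebra.basis G k).tensorProduct b).constr_basis k
    (fun p => (D.F (D.deg p.2) p.1 : k) • b p.2) (a, S)
  rwa [Module.Basis.tensorProduct_apply, MonoidAlgebra.basis_apply] at this

theorem ydCoact_basis (S : Finset (Fin D.dim)) :
    D.ydCoact b (b S) = MonoidAlgebra.single (D.deg S) 1 ⊗ₜ b S := by simp [ydCoact]

theorem ydComul_basis (S : Finset (Fin D.dim)) : D.ydComul b (b S) =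
    ∑ T ∈ S.powerset, (D.comulCoef S T : k) • (b T ⊗ₜ[k] b (S \ T)) := by simp [ydComul]

@[simp] theorem ydIncl_basis (S : Finset (Fin D.dim)) : D.ydIncl b (b S) = D.mono S := by
  simp [ydIncl]

theorem deg_mul_deg_sdiff {S T : Finset (Fin D.dim)} (h : T ∈ S.powerset) :
    D.deg T * D.deg (S \ T) = D.deg S := by
  rw [mul_comm, D.deg_sdiff_mul (Finset.mem_powerset.1 h)]

/-- Either `S` is empty and has degree `1`, or the counit of `x_S` is `0`. This removes the degree
in `sum_antipodeCoef_left`. -/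
theorem grp_deg_smul_counit (S : Finset (Fin D.dim)) :
    Coalgebra.counit (R := k) (D.mono S) • D.grp (D.deg S) =
      Coalgebra.counit (R := k) (D.mono S) • 1 := by
  rcases S.eq_empty_or_nonempty with rfl | h
  · simp
  · rw [counit_mono _ h, zero_smul, zero_smul]

theorem ydCounit_basis (S : Finset (Fin D.dim)) :
    D.ydCounit b (b S) = Coalgebra.counit (R := k) (D.mono S) := by simp [ydCounit]

/-! ### The braided operations on basis vectors -/

theorem actTwist_ydAct (a : G) (S : Finset (Fin D.dim)) :
    actTwist (D.ydAct b) (MonoidAlgebra.single a 1 ⊗ₜ b S) =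
      (D.F (D.deg S) a : k) • (b S ⊗ₜ MonoidAlgebra.single a 1) := by
  simp [actTwist, ydAct_single, TensorProduct.smul_tmul']

theorem coactTwist_ydCoact (a : G) (S : Finset (Fin D.dim)) :
    coactTwist (D.ydCoact b) (b S ⊗ₜ MonoidAlgebra.single a 1) =
      MonoidAlgebra.single (D.deg S * a) 1 ⊗ₜ b S := by
  simp [coactTwist, ydCoact_basis]

theorem diagAct_ydAct (a : G) (S T : Finset (Fin D.dim)) :
    diagAct (D.ydAct b) (D.ydAct b) (MonoidAlgebra.single a 1 ⊗ₜ (b S ⊗ₜ b T)) =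
      (D.F (D.deg S * D.deg T) a : k) • (b S ⊗ₜ b T) := by
  simp [diagAct, ydAct_single, TensorProduct.smul_tmul', TensorProduct.tmul_smul, smul_smul,
    mul_comm]

theorem diagCoact_ydCoact (S T : Finset (Fin D.dim)) :
    diagCoact (D.ydCoact b) (D.ydCoact b) (b S ⊗ₜ b T) =
      MonoidAlgebra.single (D.deg S * D.deg T) 1 ⊗ₜ (b S ⊗ₜ b T) := by
  simp [diagCoact, ydCoact_basis]

/-- The scalar stays inside the first factor to keep the value in the shape that `midMap_tmul`
expects. -/
theorem ydBraiding_basis (S T : Finset (Fin D.dim)) :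
    ydBraiding (D.ydCoact b) (D.ydAct b) (b S ⊗ₜ b T) =
      ((D.F (D.deg T) (D.deg S) : k) • b T) ⊗ₜ b S := by
  simp [ydBraiding, ydCoact_basis, ydAct_single]

/-! ### Compatibility with the operations of `H(D)` -/

variable [CharZero k]

/-- The multiplication of the span of the `x_S`. -/
noncomputable def ydMul : B ⊗[k] B →ₗ[k] B :=
  (b.tensorProduct b).constr k fun p => D.mulCoef p.1 p.2 • b (p.1 ∪ p.2)

/-- The projection of `H(D)` onto the span of the `x_S`, `x_S a ↦ x_S`. -/
noncomputable def ydProj : D.H →ₗ[k] B := D.pbw.constr k fun p => b p.1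

theorem ydMul_basis (S T : Finset (Fin D.dim)) :
    D.ydMul b (b S ⊗ₜ b T) = D.mulCoef S T • b (S ∪ T) := by
  have := (b.tensorProduct b).constr_basis k
    (fun p => D.mulCoef p.1 p.2 • b (p.1 ∪ p.2)) (S, T)
  rwa [Module.Basis.tensorProduct_apply] at this

@[simp] theorem ydProj_mono_mul_grp (S : Finset (Fin D.dim)) (a : G) :
    D.ydProj b (D.mono S * D.grp a) = b S := by
  rw [← D.pbw_apply (S, a), ydProj, Module.Basis.constr_basis]

@[simp] theorem ydProj_mono (S : Finset (Fin D.dim)) : D.ydProj b (D.mono S) = b S := by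
  have := D.ydProj_mono_mul_grp b S 1
  rwa [map_one, mul_one] at this

theorem ydProj_mul_grp (x : D.H) (a : G) : D.ydProj b (x * D.grp a) = D.ydProj b x := by
  induction x using Module.Basis.induction_on D.pbw with
  | basis p => simp [mul_assoc, ← map_mul]
  | zero => simp
  | add x y hx hy => rw [add_mul, map_add, map_add, hx, hy]
  | smul c x hx => rw [smul_mul_assoc, map_smul, map_smul, hx]

theorem ydProj_ydIncl (x : B) : D.ydProj b (D.ydIncl b x) = x := by
  have : D.ydProj b ∘ₗ D.ydIncl b = LinearMap.id := b.ext fun S => by simp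
  exact LinearMap.congr_fun this x

theorem ydIncl_injective : Function.Injective (D.ydIncl b) :=
  Function.LeftInverse.injective (D.ydProj_ydIncl b)

theorem ydProj_surjective : Function.Surjective (D.ydProj b) := fun x => ⟨_, D.ydProj_ydIncl b x⟩

theorem ydIncl_mul (x y : B) : D.ydIncl b (D.ydMul b (x ⊗ₜ y)) = D.ydIncl b x * D.ydIncl b y := by
  have : D.ydIncl b ∘ₗ D.ydMul b =
      LinearMap.mul' k D.H ∘ₗ TensorProduct.map (D.ydIncl b) (D.ydIncl b) := by
    refine (b.tensorProduct b).ext fun ⟨S, T⟩ => ?_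
    simp [ydMul_basis, mono_mul_mono]
  exact LinearMap.congr_fun this (x ⊗ₜ y)

theorem ydProj_mono_mul_mono (S T : Finset (Fin D.dim)) :
    D.ydProj b (D.mono S * D.mono T) = D.ydMul b (b S ⊗ₜ b T) := by
  rw [mono_mul_mono, map_smul, ydProj_mono, ydMul_basis]

/-- The projection forgets the grouplike factors, the only difference between the two coproducts. It
is thus a surjection of coalgebras, along which coassociativity and the counit laws descend from
`H(D)`, just as associativity is inherited along `ydIncl`. -/
theorem ydComul_ydProj (x : D.H) : D.ydComul b (D.ydProj b x) =
    TensorProduct.map (D.ydProj b) (D.ydProj b) (Coalgebra.comul (R := k) x) := by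
  have : D.ydComul b ∘ₗ D.ydProj b =
      TensorProduct.map (D.ydProj b) (D.ydProj b) ∘ₗ Coalgebra.comul := by
    refine D.pbw.ext fun ⟨S, a⟩ => ?_
    simp [ydComul_basis, comul_mono_mul_grp, -Bialgebra.comul_mul, -map_mul]
  exact LinearMap.congr_fun this x

theorem ydCounit_ydProj (x : D.H) :
    D.ydCounit b (D.ydProj b x) = Coalgebra.counit (R := k) x := by
  have : D.ydCounit b ∘ₗ D.ydProj b = Coalgebra.counit := by
    refine D.pbw.ext fun ⟨S, a⟩ => ?_
    simp [ydCounit_basis]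
  exact LinearMap.congr_fun this x

/-- The degree may be treated as multiplicative in any expression that carries the coefficient of
the product, since that coefficient vanishes when `S` and `T` meet. -/
theorem mulCoef_smul_eq (S T : Finset (Fin D.dim)) {M : Type*} [AddCommGroup M] [Module k M]
    {f : G → M} : D.mulCoef S T • f (D.deg (S ∪ T)) = D.mulCoef S T • f (D.deg S * D.deg T) := by
  by_cases h : Disjoint S T
  · rw [D.deg_union h]
  · simp [D.mulCoef_of_not_disjoint h]

/-! ### The antipode -/

/-- The antipode reverses the product and puts a `g_i⁻¹` beside each `x_i`; collecting these and
reordering costs only scalars. The braided antipode is `x_S ↦ g_S` times this value, a multiple of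
`x_S`. -/
theorem exists_antipode_mono (S : Finset (Fin D.dim)) :
    ∃ c : k, D.antipodeLin (D.mono S) = c • (D.grp (D.deg S)⁻¹ * D.mono S) := by
  induction S using Finset.induction_on_min with
  | empty => exact ⟨1, by simpa using D.antipodeLin_algebraMap 1⟩
  | insert i S h ih =>
    have hi : i ∉ S := fun hi => lt_irrefl _ (h i hi)
    obtain ⟨c, hc⟩ := ih
    have e : D.antipodeLin (D.gen i) = -(D.grp (D.wt i).1⁻¹ * D.gen i) := D.antipodeLin_vec _ _
    refine ⟨-(c * (D.F (D.wt i).1⁻¹ (D.deg S) : k) * D.mulCoef S {i}), ?_⟩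
    rw [D.deg_insert hi, mul_inv_rev, map_mul, D.mono_insert h, antipodeLin_mul, hc, e,
      ← D.mono_insert h, mul_neg, smul_mul_assoc, mul_assoc, ← mul_assoc (D.mono S), mono_mul_grp,
      smul_mul_assoc, mul_assoc (D.grp _) (D.mono S), ← mono_singleton, mono_mul_mono,
      Finset.union_comm, ← Finset.insert_eq]
    simp only [mul_smul_comm, smul_smul, neg_smul, mul_assoc]

/-- The coefficient of the antipode on a monomial. -/
noncomputable def antipodeCoef (S : Finset (Fin D.dim)) : k := (D.exists_antipode_mono S).choose

theorem antipode_mono (S : Finset (Fin D.dim)) :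
    D.antipodeLin (D.mono S) = D.antipodeCoef S • (D.grp (D.deg S)⁻¹ * D.mono S) :=
  (D.exists_antipode_mono S).choose_spec

/-- The braided antipode of the span of the `x_S`. -/
noncomputable def ydAntipode : B →ₗ[k] B := b.constr k fun S => D.antipodeCoef S • b S

theorem ydAntipode_basis (S : Finset (Fin D.dim)) :
    D.ydAntipode b (b S) = D.antipodeCoef S • b S := by simp [ydAntipode]

theorem sum_antipodeCoef_left (S : Finset (Fin D.dim)) :
    ∑ T ∈ S.powerset, (D.comulCoef S T : k) • D.antipodeCoef T • (D.mono T * D.mono (S \ T)) =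
      Coalgebra.counit (R := k) (D.mono S) • 1 := by
  have h := HopfAlgebra.mul_antipode_rTensor_comul_apply (R := k) (D.mono S)
  change LinearMap.mul' k D.H (LinearMap.rTensor D.H D.antipodeLin _) = _ at h
  -- Left multiplication by `g_S = g_T g_{S∖T}` cancels the inverses that the antipode of `x_T
  -- g_{S∖T}` brings in. In `sum_antipodeCoef_right` they cancel unaided.
  have h' := congrArg (D.grp (D.deg S) * ·) h
  simp only [Algebra.algebraMap_eq_smul_one, mul_smul_comm, mul_one, grp_deg_smul_counit] at h'
  rw [← h', comul_mono, map_sum, map_sum, Finset.mul_sum]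
  refine Finset.sum_congr rfl fun T hT => ?_
  rw [map_smul, map_smul, LinearMap.rTensor_tmul, LinearMap.mul'_apply, antipodeLin_mul,
    antipodeLin_grp, antipode_mono, ← D.deg_mul_deg_sdiff hT]
  simp only [mul_smul_comm, smul_mul_assoc, ← mul_assoc, ← map_mul]
  simp

theorem sum_antipodeCoef_right (S : Finset (Fin D.dim)) :
    ∑ T ∈ S.powerset,
        (D.comulCoef S T : k) • D.antipodeCoef (S \ T) • (D.mono T * D.mono (S \ T)) =
      Coalgebra.counit (R := k) (D.mono S) • 1 := by
  have h := HopfAlgebra.mul_antipode_lTensor_comul_apply (R := k) (D.mono S)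
  change LinearMap.mul' k D.H (LinearMap.lTensor D.H D.antipodeLin _) = _ at h
  rw [Algebra.algebraMap_eq_smul_one] at h
  rw [← h, comul_mono, map_sum, map_sum]
  refine Finset.sum_congr rfl fun T hT => ?_
  rw [map_smul, map_smul, LinearMap.lTensor_tmul, LinearMap.mul'_apply, antipode_mono,
    mul_smul_comm, mul_assoc, ← mul_assoc (D.grp _) (D.grp _), ← map_mul, mul_inv_cancel, map_one,
    one_mul]

end Datum

namespace Datum

variable {k G : Type*} [Field k] [CommGroup G] (D : Datum k G) [Finite G]
  {B : Type*} [AddCommGroup B] [Module k B] (b : Module.Basis (Finset (Fin D.dim)) k B)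

/-! ### The axioms -/

theorem yd_one_act (x : B) : D.ydAct b (1 ⊗ₜ x) = x := by
  have : D.ydAct b ∘ₗ TensorProduct.mk k (MonoidAlgebra k G) B 1 = LinearMap.id := by
    refine b.ext fun S => ?_
    simp [MonoidAlgebra.one_def, ydAct_single]
  exact LinearMap.congr_fun this x

theorem yd_mul_act (h h' : MonoidAlgebra k G) (x : B) :
    D.ydAct b ((h * h') ⊗ₜ x) = D.ydAct b (h ⊗ₜ D.ydAct b (h' ⊗ₜ x)) := by
  have : D.ydAct b ∘ₗ LinearMap.rTensor B (LinearMap.mul' k (MonoidAlgebra k G)) =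
      D.ydAct b ∘ₗ LinearMap.lTensor (MonoidAlgebra k G) (D.ydAct b) ∘ₗ
        (TensorProduct.assoc k _ _ _).toLinearMap := by
    refine (((MonoidAlgebra.basis G k).tensorProduct (MonoidAlgebra.basis G k)).tensorProduct b).ext
      fun ⟨⟨a, c⟩, S⟩ => ?_
    simp [ydAct_single, smul_smul, mul_comm]
  exact LinearMap.congr_fun this ((h ⊗ₜ h') ⊗ₜ x)

theorem yd_counit_coact (x : B) : TensorProduct.lid k B (LinearMap.rTensor B
    (Coalgebra.counit (R := k) (A := MonoidAlgebra k G)) (D.ydCoact b x)) = x := by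
  have : (TensorProduct.lid k B).toLinearMap ∘ₗ LinearMap.rTensor B
    (Coalgebra.counit (R := k) (A := MonoidAlgebra k G)) ∘ₗ D.ydCoact b = LinearMap.id := by
    refine b.ext fun S => ?_
    simp [ydCoact_basis]
  exact LinearMap.congr_fun this x

theorem yd_coassoc_coact (x : B) :
    TensorProduct.assoc k _ _ B (LinearMap.rTensor B
      (Coalgebra.comul (R := k) (A := MonoidAlgebra k G)) (D.ydCoact b x)) =
      LinearMap.lTensor (MonoidAlgebra k G) (D.ydCoact b) (D.ydCoact b x) := by
  have : (TensorProduct.assoc k _ _ B).toLinearMap ∘ₗ LinearMap.rTensor B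
      (Coalgebra.comul (R := k) (A := MonoidAlgebra k G)) ∘ₗ D.ydCoact b =
      LinearMap.lTensor (MonoidAlgebra k G) (D.ydCoact b) ∘ₗ D.ydCoact b := by
    refine b.ext fun S => ?_
    simp [ydCoact_basis]
  exact LinearMap.congr_fun this x

theorem yd_yetter_drinfeld :
    TensorProduct.map (LinearMap.mul' k (MonoidAlgebra k G)) (D.ydAct b) ∘ₗ
        (TensorProduct.tensorTensorTensorComm k _ _ _ B).toLinearMap ∘ₗ
        TensorProduct.map (Coalgebra.comul (R := k) (A := MonoidAlgebra k G)) (D.ydCoact b) =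
      coactTwist (D.ydCoact b) ∘ₗ actTwist (D.ydAct b) := by
  refine ((MonoidAlgebra.basis G k).tensorProduct b).ext fun ⟨a, S⟩ => ?_
  simp [actTwist_ydAct, coactTwist_ydCoact, ydCoact_basis, ydAct_single, mul_comm]

theorem yd_comul_act (h : MonoidAlgebra k G) (x : B) :
    D.ydComul b (D.ydAct b (h ⊗ₜ x)) =
      diagAct (D.ydAct b) (D.ydAct b) (h ⊗ₜ D.ydComul b x) := by
  have : D.ydComul b ∘ₗ D.ydAct b = diagAct (D.ydAct b) (D.ydAct b) ∘ₗ
      LinearMap.lTensor (MonoidAlgebra k G) (D.ydComul b) := by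
    refine ((MonoidAlgebra.basis G k).tensorProduct b).ext fun ⟨a, S⟩ => ?_
    simp only [Module.Basis.tensorProduct_apply, MonoidAlgebra.basis_apply, LinearMap.comp_apply,
      ydAct_single, LinearMap.lTensor_tmul, map_smul, ydComul_basis, TensorProduct.tmul_sum,
      map_sum, TensorProduct.tmul_smul, diagAct_ydAct, Finset.smul_sum]
    refine Finset.sum_congr rfl fun T hT => ?_
    rw [D.deg_mul_deg_sdiff hT, smul_comm]
  exact LinearMap.congr_fun this (h ⊗ₜ x)

theorem yd_counit_act (h : MonoidAlgebra k G) (x : B) :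
    D.ydCounit b (D.ydAct b (h ⊗ₜ x)) = Coalgebra.counit (R := k) h * D.ydCounit b x := by
  have : D.ydCounit b ∘ₗ D.ydAct b = LinearMap.mul' k k ∘ₗ
      TensorProduct.map (Coalgebra.counit (R := k)) (D.ydCounit b) := by
    refine ((MonoidAlgebra.basis G k).tensorProduct b).ext fun ⟨a, S⟩ => ?_
    rcases S.eq_empty_or_nonempty with rfl | hS
    · simp [ydAct_single]
    · simp [ydAct_single, ydCounit_basis, counit_mono _ hS]
  exact LinearMap.congr_fun this (h ⊗ₜ x)

theorem yd_coact_comul (x : B) :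
    LinearMap.lTensor (MonoidAlgebra k G) (D.ydComul b) (D.ydCoact b x) =
      diagCoact (D.ydCoact b) (D.ydCoact b) (D.ydComul b x) := by
  have : LinearMap.lTensor (MonoidAlgebra k G) (D.ydComul b) ∘ₗ D.ydCoact b =
      diagCoact (D.ydCoact b) (D.ydCoact b) ∘ₗ D.ydComul b := by
    refine b.ext fun S => ?_
    simp only [LinearMap.comp_apply, LinearMap.lTensor_tmul, map_smul, ydComul_basis,
      TensorProduct.tmul_sum, map_sum, TensorProduct.tmul_smul, diagCoact_ydCoact, ydCoact_basis]
    refine Finset.sum_congr rfl fun T hT => ?_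
    rw [D.deg_mul_deg_sdiff hT]
  exact LinearMap.congr_fun this x

theorem yd_coact_counit (x : B) :
    LinearMap.lTensor (MonoidAlgebra k G) (D.ydCounit b) (D.ydCoact b x) =
      1 ⊗ₜ D.ydCounit b x := by
  have : LinearMap.lTensor (MonoidAlgebra k G) (D.ydCounit b) ∘ₗ D.ydCoact b =
      TensorProduct.mk k _ _ 1 ∘ₗ D.ydCounit b := by
    refine b.ext fun S => ?_
    rcases S.eq_empty_or_nonempty with rfl | hS
    · simp [ydCoact_basis, MonoidAlgebra.one_def]
    · simp [ydCoact_basis, ydCounit_basis, counit_mono _ hS]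
  exact LinearMap.congr_fun this x

theorem yd_act_one (h : MonoidAlgebra k G) :
    D.ydAct b (h ⊗ₜ b ∅) = Coalgebra.counit (R := k) h • b ∅ := by
  have : D.ydAct b ∘ₗ (TensorProduct.mk k _ B).flip (b ∅) =
      (Coalgebra.counit (R := k) (A := MonoidAlgebra k G)).smulRight (b ∅) := by
    refine (MonoidAlgebra.basis G k).ext fun a => ?_
    simp [ydAct_single]
  exact LinearMap.congr_fun this h

theorem mul'_map_ydIncl (S : Finset (Fin D.dim)) (a : G) :
    (LinearMap.mul' k D.H ∘ₗ TensorProduct.map (D.ydIncl b) D.groupAlg.toLinearMap)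
      (b S ⊗ₜ MonoidAlgebra.single a 1) = D.mono S * D.grp a := by
  simp [groupAlg]

variable [CharZero k]

theorem yd_act_mul (h : MonoidAlgebra k G) (x y : B) :
    D.ydAct b (h ⊗ₜ D.ydMul b (x ⊗ₜ y)) =
      D.ydMul b (diagAct (D.ydAct b) (D.ydAct b) (h ⊗ₜ (x ⊗ₜ y))) := by
  have : D.ydAct b ∘ₗ LinearMap.lTensor (MonoidAlgebra k G) (D.ydMul b) =
      D.ydMul b ∘ₗ diagAct (D.ydAct b) (D.ydAct b) := by
    refine ((MonoidAlgebra.basis G k).tensorProduct (b.tensorProduct b)).ext fun ⟨a, S, T⟩ => ?_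
    simp only [Module.Basis.tensorProduct_apply, MonoidAlgebra.basis_apply, LinearMap.comp_apply,
      LinearMap.lTensor_tmul, ydMul_basis, diagAct_ydAct, TensorProduct.tmul_smul, map_smul,
      ydAct_single]
    exact (D.mulCoef_smul_eq S T (f := fun g => (D.F g a : k) • b (S ∪ T))).trans
      (smul_comm _ _ _)
  exact LinearMap.congr_fun this (h ⊗ₜ (x ⊗ₜ y))

theorem yd_coact_mul (x y : B) : D.ydCoact b (D.ydMul b (x ⊗ₜ y)) =
    LinearMap.lTensor (MonoidAlgebra k G) (D.ydMul b)
      (diagCoact (D.ydCoact b) (D.ydCoact b) (x ⊗ₜ y)) := by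
  have : D.ydCoact b ∘ₗ D.ydMul b = LinearMap.lTensor (MonoidAlgebra k G) (D.ydMul b) ∘ₗ
      diagCoact (D.ydCoact b) (D.ydCoact b) := by
    refine (b.tensorProduct b).ext fun ⟨S, T⟩ => ?_
    simp only [Module.Basis.tensorProduct_apply, LinearMap.comp_apply,
      LinearMap.lTensor_tmul, ydMul_basis, diagCoact_ydCoact, TensorProduct.tmul_smul, map_smul,
      ydCoact_basis]
    exact D.mulCoef_smul_eq S T (f := fun g => MonoidAlgebra.single g (1 : k) ⊗ₜ[k] b (S ∪ T))
  exact LinearMap.congr_fun this (x ⊗ₜ y)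

theorem yd_coassoc (x : B) :
    TensorProduct.assoc k B B B (LinearMap.rTensor B (D.ydComul b) (D.ydComul b x)) =
      LinearMap.lTensor B (D.ydComul b) (D.ydComul b x) := by
  obtain ⟨h, rfl⟩ := D.ydProj_surjective b x
  set p := D.ydProj b with hp
  have h1 : ∀ z : D.H ⊗[k] D.H, LinearMap.rTensor B (D.ydComul b) (TensorProduct.map p p z) =
      TensorProduct.map (TensorProduct.map p p) p
        (LinearMap.rTensor D.H (Coalgebra.comul (R := k)) z) := by
    intro z
    induction z with
    | zero => simp
    | add y z hy hz => simp only [map_add, hy, hz]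
    | tmul y z => simp [hp, ydComul_ydProj]
  have h2 : ∀ z : D.H ⊗[k] D.H, LinearMap.lTensor B (D.ydComul b) (TensorProduct.map p p z) =
      TensorProduct.map p (TensorProduct.map p p)
        (LinearMap.lTensor D.H (Coalgebra.comul (R := k)) z) := by
    intro z
    induction z with
    | zero => simp
    | add y z hy hz => simp only [map_add, hy, hz]
    | tmul y z => simp [hp, ydComul_ydProj]
  rw [hp, ydComul_ydProj, ← hp, h1, h2, ← Coalgebra.coassoc_apply, TensorProduct.map_map_assoc]

theorem yd_rTensor_counit_comul (x : B) :
    LinearMap.rTensor B (D.ydCounit b) (D.ydComul b x) = 1 ⊗ₜ x := by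
  obtain ⟨h, rfl⟩ := D.ydProj_surjective b x
  have h1 : ∀ z : D.H ⊗[k] D.H, LinearMap.rTensor B (D.ydCounit b)
      (TensorProduct.map (D.ydProj b) (D.ydProj b) z) =
      LinearMap.lTensor k (D.ydProj b) (LinearMap.rTensor D.H (Coalgebra.counit (R := k)) z) := by
    intro z
    induction z with
    | zero => simp
    | add y z hy hz => simp only [map_add, hy, hz]
    | tmul y z => simp [ydCounit_ydProj]
  rw [ydComul_ydProj, h1, Coalgebra.rTensor_counit_comul, LinearMap.lTensor_tmul]

theorem yd_lTensor_counit_comul (x : B) :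
    LinearMap.lTensor B (D.ydCounit b) (D.ydComul b x) = x ⊗ₜ 1 := by
  obtain ⟨h, rfl⟩ := D.ydProj_surjective b x
  have h1 : ∀ z : D.H ⊗[k] D.H, LinearMap.lTensor B (D.ydCounit b)
      (TensorProduct.map (D.ydProj b) (D.ydProj b) z) =
      LinearMap.rTensor k (D.ydProj b) (LinearMap.lTensor D.H (Coalgebra.counit (R := k)) z) := by
    intro z
    induction z with
    | zero => simp
    | add y z hy hz => simp only [map_add, hy, hz]
    | tmul y z => simp [ydCounit_ydProj]
  rw [ydComul_ydProj, h1, Coalgebra.lTensor_counit_comul, LinearMap.rTensor_tmul]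

/-- Project the identity `Δ(x_S x_T) = Δ(x_S) Δ(x_T)` of `H(D)`. Its left factors are `x_U g_{S∖U}
x_W g_{T∖W}`; moving `g_{S∖U}` past `x_W` costs `F(g_W, g_{S∖U})`, the scalar of the braiding, and
then the projection removes the grouplikes. -/
theorem yd_comul_mul (x y : B) : D.ydComul b (D.ydMul b (x ⊗ₜ y)) =
    TensorProduct.map (D.ydMul b) (D.ydMul b)
      (midMap k (ydBraiding (D.ydCoact b) (D.ydAct b)) (D.ydComul b x ⊗ₜ D.ydComul b y)) := by
  have : D.ydComul b ∘ₗ D.ydMul b = TensorProduct.map (D.ydMul b) (D.ydMul b) ∘ₗ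
      midMap k (ydBraiding (D.ydCoact b) (D.ydAct b)) ∘ₗ
        TensorProduct.map (D.ydComul b) (D.ydComul b) := by
    refine (b.tensorProduct b).ext fun ⟨S, T⟩ => ?_
    rw [Module.Basis.tensorProduct_apply, LinearMap.comp_apply, ← ydProj_mono_mul_mono,
      ydComul_ydProj, Bialgebra.comul_mul, comul_mono, comul_mono, LinearMap.comp_apply,
      LinearMap.comp_apply, TensorProduct.map_tmul, ydComul_basis, ydComul_basis,
      Finset.sum_mul_sum, map_sum, TensorProduct.sum_tmul, map_sum, map_sum]
    refine Finset.sum_congr rfl fun U hU => ?_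
    rw [TensorProduct.tmul_sum, map_sum, map_sum, map_sum]
    refine Finset.sum_congr rfl fun W hW => ?_
    rw [smul_mul_smul_comm, TensorProduct.smul_tmul_smul, map_smul, map_smul, map_smul,
      Algebra.TensorProduct.tmul_mul_tmul, TensorProduct.map_tmul, ydProj_mono_mul_mono,
      midMap_tmul _ _ _ _ _ (D.ydBraiding_basis b (S \ U) W), TensorProduct.map_tmul,
      TensorProduct.tmul_smul, map_smul, ← ydProj_mono_mul_mono, mul_assoc,
      ← mul_assoc (D.grp _) (D.mono W), grp_mul_mono, ← mul_assoc, ydProj_mul_grp, mul_smul_comm,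
      ← mul_assoc, map_smul, ydProj_mul_grp, ← ydProj_mono_mul_mono D b U W]
  exact LinearMap.congr_fun this (x ⊗ₜ y)

theorem yd_antipode_act (h : MonoidAlgebra k G) (x : B) :
    D.ydAntipode b (D.ydAct b (h ⊗ₜ x)) = D.ydAct b (h ⊗ₜ D.ydAntipode b x) := by
  have : D.ydAntipode b ∘ₗ D.ydAct b =
      D.ydAct b ∘ₗ LinearMap.lTensor (MonoidAlgebra k G) (D.ydAntipode b) := by
    refine ((MonoidAlgebra.basis G k).tensorProduct b).ext fun ⟨a, S⟩ => ?_
    simp [ydAct_single, ydAntipode_basis, smul_smul, mul_comm]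
  exact LinearMap.congr_fun this (h ⊗ₜ x)

theorem yd_antipode_coact (x : B) : D.ydCoact b (D.ydAntipode b x) =
    LinearMap.lTensor (MonoidAlgebra k G) (D.ydAntipode b) (D.ydCoact b x) := by
  have : D.ydCoact b ∘ₗ D.ydAntipode b =
      LinearMap.lTensor (MonoidAlgebra k G) (D.ydAntipode b) ∘ₗ D.ydCoact b := by
    refine b.ext fun S => ?_
    simp [ydCoact_basis, ydAntipode_basis]
  exact LinearMap.congr_fun this x

theorem yd_mul_antipode_left (x : B) :
    D.ydMul b (LinearMap.rTensor B (D.ydAntipode b) (D.ydComul b x)) = D.ydCounit b x • b ∅ := by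
  have : D.ydMul b ∘ₗ LinearMap.rTensor B (D.ydAntipode b) ∘ₗ D.ydComul b =
      (D.ydCounit b).smulRight (b ∅) := by
    -- Both sides are compared inside `H(D)`, where the identity is the one derived from its
    -- antipode.
    refine b.ext fun S => D.ydIncl_injective b ?_
    have := D.sum_antipodeCoef_left S
    simp only [LinearMap.comp_apply, ydComul_basis, map_sum, map_smul, LinearMap.rTensor_tmul,
      ydAntipode_basis, ydIncl_mul, ydIncl_basis, LinearMap.smulRight_apply, ydCounit_basis,
      mono_empty, smul_mul_assoc, this]
  exact LinearMap.congr_fun this x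

theorem yd_mul_antipode_right (x : B) :
    D.ydMul b (LinearMap.lTensor B (D.ydAntipode b) (D.ydComul b x)) = D.ydCounit b x • b ∅ := by
  have : D.ydMul b ∘ₗ LinearMap.lTensor B (D.ydAntipode b) ∘ₗ D.ydComul b =
      (D.ydCounit b).smulRight (b ∅) := by
    refine b.ext fun S => D.ydIncl_injective b ?_
    have := D.sum_antipodeCoef_right S
    simp only [LinearMap.comp_apply, ydComul_basis, map_sum, map_smul, LinearMap.lTensor_tmul,
      ydAntipode_basis, ydIncl_mul, ydIncl_basis, LinearMap.smulRight_apply, ydCounit_basis,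
      mono_empty, mul_smul_comm, this]
  exact LinearMap.congr_fun this x

/-- The Hopf algebra in the Yetter-Drinfeld category on a space with a basis indexed by the
monomials `x_S`. -/
noncomputable def ydHopf : YetterDrinfeldHopf k (MonoidAlgebra k G) B where
  act := D.ydAct b
  coact := D.ydCoact b
  mul := D.ydMul b
  one := b ∅
  comul := D.ydComul b
  counit := D.ydCounit b
  antipode := D.ydAntipode b
  one_act := D.yd_one_act b
  mul_act := D.yd_mul_act b
  counit_coact := D.yd_counit_coact b
  coassoc_coact := D.yd_coassoc_coact b
  yetter_drinfeld := D.yd_yetter_drinfeld b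
  mul_assoc x y z := D.ydIncl_injective b (by simp only [ydIncl_mul, mul_assoc])
  one_mul x := D.ydIncl_injective b (by simp [ydIncl_mul])
  mul_one x := D.ydIncl_injective b (by simp [ydIncl_mul])
  act_mul := D.yd_act_mul b
  act_one := D.yd_act_one b
  coact_mul := D.yd_coact_mul b
  coact_one := by rw [ydCoact_basis, deg_empty]; rfl
  coassoc := D.yd_coassoc b
  rTensor_counit_comul := D.yd_rTensor_counit_comul b
  lTensor_counit_comul := D.yd_lTensor_counit_comul b
  comul_act := D.yd_comul_act b
  counit_act := D.yd_counit_act b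
  coact_comul := D.yd_coact_comul b
  coact_counit := D.yd_coact_counit b
  comul_mul := D.yd_comul_mul b
  comul_one := by
    rw [← ydProj_mono D b ∅, ydComul_ydProj, mono_empty, Bialgebra.comul_one,
      Algebra.TensorProduct.one_def, TensorProduct.map_tmul]
  counit_mul x y := by
    simp only [ydCounit, LinearMap.comp_apply, ydIncl_mul, Bialgebra.counit_mul]
  counit_one := by rw [ydCounit_basis, mono_empty, Bialgebra.counit_one]
  antipode_act := D.yd_antipode_act b
  antipode_coact := D.yd_antipode_coact b
  mul_antipode_left := D.yd_mul_antipode_left b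
  mul_antipode_right := D.yd_mul_antipode_right b

/-! ### The biproduct -/

theorem isBiproductIso_ydHopf :
    (D.ydHopf b).IsBiproductIso
      (LinearMap.mul' k D.H ∘ₗ TensorProduct.map (D.ydIncl b) D.groupAlg.toLinearMap) := by
  have hb := D.mul'_map_ydIncl b
  -- The first four clauses need only the values of `Φ` on basis vectors; the definition returns for
  -- the counit.
  generalize hΦ :
    LinearMap.mul' k D.H ∘ₗ TensorProduct.map (D.ydIncl b) D.groupAlg.toLinearMap = Φ at hb ⊢
  refine ⟨?_, ?_, ?_, ?_, ?_⟩
  -- `Φ` matches the basis `b S ⊗ a` with the monomial basis `x_S a`.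
  · have : Φ = ((b.tensorProduct (MonoidAlgebra.basis G k)).equiv D.pbw
        (Equiv.refl _)).toLinearMap := by
      refine (b.tensorProduct (MonoidAlgebra.basis G k)).ext fun ⟨S, a⟩ => ?_
      rw [LinearEquiv.coe_coe, Module.Basis.equiv_apply, Module.Basis.tensorProduct_apply,
        MonoidAlgebra.basis_apply, hb]
      simp
    rw [this]
    exact LinearEquiv.bijective _
  · have : Φ ∘ₗ (D.ydHopf b).smashMul = LinearMap.mul' k D.H ∘ₗ TensorProduct.map Φ Φ := by
      refine ((b.tensorProduct (MonoidAlgebra.basis G k)).tensorProduct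
        (b.tensorProduct (MonoidAlgebra.basis G k))).ext fun ⟨⟨S, a⟩, ⟨T, c⟩⟩ => ?_
      simp only [Module.Basis.tensorProduct_apply, MonoidAlgebra.basis_apply]
      rw [LinearMap.comp_apply, LinearMap.comp_apply, TensorProduct.map_tmul, hb, hb,
        LinearMap.mul'_apply, YetterDrinfeldHopf.smashMul, LinearMap.comp_apply]
      change Φ (TensorProduct.map (D.ydMul b) _ (midMap k (actTwist (D.ydAct b)) _)) = _
      rw [midMap_tmul _ _ _ _ _ (D.actTwist_ydAct b a T), TensorProduct.map_tmul,
        TensorProduct.tmul_smul, map_smul, ydMul_basis, LinearMap.mul'_apply,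
        MonoidAlgebra.single_mul_single, mul_one, ← TensorProduct.smul_tmul', map_smul,
        ← TensorProduct.smul_tmul', map_smul, hb, mul_assoc, ← mul_assoc (D.grp a),
        grp_mul_mono, smul_mul_assoc, mul_smul_comm, mul_assoc,
        ← map_mul, ← mul_assoc, mono_mul_mono, smul_mul_assoc, smul_comm]
    exact fun u v => LinearMap.congr_fun this (u ⊗ₜ v)
  · change Φ (b ∅ ⊗ₜ 1) = 1
    rw [MonoidAlgebra.one_def, hb, mono_empty, map_one, one_mul]
  · have : Coalgebra.comul ∘ₗ Φ = TensorProduct.map Φ Φ ∘ₗ (D.ydHopf b).smashComul := by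
      refine (b.tensorProduct (MonoidAlgebra.basis G k)).ext fun ⟨S, a⟩ => ?_
      simp only [Module.Basis.tensorProduct_apply, MonoidAlgebra.basis_apply]
      rw [LinearMap.comp_apply, LinearMap.comp_apply, hb, comul_mono_mul_grp,
        YetterDrinfeldHopf.smashComul, LinearMap.comp_apply, TensorProduct.map_tmul]
      change _ = TensorProduct.map Φ Φ (midMap k (coactTwist (D.ydCoact b)) (D.ydComul b (b S) ⊗ₜ _))
      rw [ydComul_basis, TensorProduct.sum_tmul, map_sum, map_sum]
      refine Finset.sum_congr rfl fun T _ => ?_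
      rw [← TensorProduct.smul_tmul', map_smul, map_smul, MonoidAlgebra.comul_single,
        CommSemiring.comul_apply, TensorProduct.map_tmul, MonoidAlgebra.lsingle_apply,
        midMap_tmul _ _ _ _ _ (D.coactTwist_ydCoact b a (S \ T)), TensorProduct.map_tmul, hb, hb]
    exact fun u => LinearMap.congr_fun this u
  · subst hΦ
    intro x h
    change Coalgebra.counit (R := k) (D.ydIncl b x * D.groupAlg h) =
      Coalgebra.counit (R := k) (D.ydIncl b x) * _
    rw [Bialgebra.counit_mul]
    congr 1
    induction h using MonoidAlgebra.induction_linear with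
    | zero => simp
    | add x y hx hy => rw [map_add, map_add, map_add, hx, hy]
    | single a c => simp [groupAlg]

theorem exists_isBiproductIso {m : ℕ} (e : Fin m ≃ D.I) :
    ∃ Y : YetterDrinfeldHopf k (MonoidAlgebra k G) D.B, Y.IsBiproductIso (D.biproductMap e) := by
  refine ⟨D.ydHopf (D.tensorBasis e), ?_⟩
  have h := D.isBiproductIso_ydHopf (D.tensorBasis e)
  -- The basis of `B` was pulled back from the `x_S` along `tensorIncl e`, so the abstract inclusion
  -- is the given one.
  have e : D.ydIncl (D.tensorBasis e) = D.tensorIncl e :=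
    (D.tensorBasis e).ext fun S => by rw [ydIncl_basis, tensorIncl_tensorBasis]
  rwa [e] at h

end Datum

/-! ### The proposition -/

theorem proposition4p3 {k G : Type*} [Field k] [IsAlgClosed k] [CharZero k]
    [CommGroup G] [Finite G] (D : Datum k G) :
    -- 1) `H(D)` is pointed, and its group of grouplike elements is `G`
    (IsPointedCoalgebra k D.H ∧ Function.Bijective D.toGroupLike) ∧
    -- 2) `H(D) = B × k[G]` is a biproduct, `B = ⨂ ⋀ V_g` being embedded by multiplication, in any
    -- order of the factors, onto the coinvariants of the projection onto `k[G]`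
    (∃ π : D.H →ₐc[k] MonoidAlgebra k G,
      (∀ a : G, π (D.grp a) = MonoidAlgebra.single a 1) ∧
      (∀ (g : D.I) (x : D.V g), π (D.vec g x) = 0) ∧
      ∀ (m : ℕ) (e : Fin m ≃ D.I),
        Set.range (D.tensorIncl e) = rightCoinvariants π ∧
        ∃ Y : YetterDrinfeldHopf k (MonoidAlgebra k G) D.B,
          Y.IsBiproductIso (D.biproductMap e)) ∧
    -- 3) the spaces `V_g` embed in `H(D)` with direct sum `𝓑`, `H(D)₁ = k[G] ⊕ k[G]𝓑`, and
    -- `P_{a,b} = span {a - b} ⊕ a V_{a⁻¹b}`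
    ((∀ g : D.I, Function.Injective (D.vec g)) ∧
      iSupIndep (fun g : D.I => LinearMap.range (D.vec g)) ∧
      coradicalFiltration k D.H 1 = D.kG ⊔ D.kG * D.vecSum ∧
      Disjoint D.kG (D.kG * D.vecSum) ∧
      ∀ a b : G,
        skewPrimitives k (D.grp a) (D.grp b) =
          Submodule.span k {D.grp a - D.grp b} ⊔
            (D.vecSpace (a⁻¹ * b)).map (LinearMap.mulLeft k (D.grp a)) ∧
        Disjoint (Submodule.span k {D.grp a - D.grp b})
          ((D.vecSpace (a⁻¹ * b)).map (LinearMap.mulLeft k (D.grp a)))) := by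
  refine ⟨⟨D.isPointedCoalgebra, D.toGroupLike_bijective⟩,
    ⟨D.proj, D.proj_grp, D.proj_vec, fun m e => ⟨?_, D.exists_isBiproductIso e⟩⟩,
    D.vec_injective, D.iSupIndep_range_vec, D.coradicalFiltration_one,
    D.disjoint_kG_kG_mul_vecSum,
    fun a b => ⟨D.skewPrimitives_eq a b, D.disjoint_span_map_vecSpace a b⟩⟩
  rw [← D.coe_monoSpan, ← D.range_tensorIncl e, LinearMap.coe_range]
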